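/- For $N\ge 0$ consider the probability densities on $\mathbb R^N$ $$\mathcal P^{\rm G}(x)=\frac1{Z^{\rm G}_N}\prod_{l=1}^N e^{-x_l^2/2}\prod_{1\le j<k\le N}|x_k-x_j|,\qquad \mathcal P^{\rm L}(x)=\frac1{Z^{\rm L}_N}\prod_{l=1}^N x_l^a e^{-x_l/2}\mathbf 1_{x_l>0}\prod_{1\le j<k\le N}|x_k-x_j|\quad(a>-1),$$ where $Z_N^{\rm G}$, $Z_N^{\rm L}$ are the normalising constants (the integrals over $\mathbb R^N$ of the unnormalised densities). For $(\cdot)={\rm G},{\rm L}$ let $E_N^{(\cdot)}(k;(s,\infty))$ be the probability that exactly $k$ of $x_1,\dots,x_N$ lie in $(s,\infty)$, and for $\zeta\in\mathbb C$ put $$\Xi_N^{(\cdot)}((s,\infty);\zeta)=\sum_{k=0}^N\zeta^kE_N^{(\cdot)}(k;(s,\infty)).$$ Write $w^{\rm G}_j(x)=x^{j-1}e^{-x^2/2}/\Gamma(j/2)$ on $I^{\rm G}=(-\infty,\infty)$ and $w^{\rm L}_j(x)=x^{a+j-1}e^{-x}/\Gamma(a+j)$ on $I^{\rm L}=(0,\infty)$.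 For $s\in\mathbb R$ (case G) or $s\ge 0$ (case L) put $I_{<}=I^{(\cdot)}\cap(-\infty,s)$, $I_{>}=(s,\infty)$ and, for $j,k\ge1$, $$H_0^{(\cdot)}(j,k;s)=\int_{I_<}dx\,w_j(x)\int_{I_<}dy\,w_k(y)\,{\rm sgn}(y-x),\qquad H_2^{(\cdot)}(j,k;s)=\int_{I_>}dx\,w_j(x)\int_{I_>}dy\,w_k(y)\,{\rm sgn}(y-x),$$ $$H_1^{(\cdot)}(j,k;s)=\int_{I_<}w_j\int_{I_>}w_k-\int_{I_<}w_k\int_{I_>}w_j,\qquad \nu_j^{(\cdot)}(s)=\int_{I_<}w_j+\zeta\int_{I_>}w_j ,$$ where $w_j=w_j^{(\cdot)}$. Let $M^{(\cdot)}_N(s)=[H_0^{(\cdot)}(j,k;s)+\zeta H_1^{(\cdot)}(j,k;s)+\zeta^2H_2^{(\cdot)}(j,k;s)]_{j,k=1}^N$. Then, for every $\zeta\in\mathbb C$ and every even $N$, $$\Xi_N^{\rm G}((s,\infty);\zeta)=2^{-N/2}\,{\rm Pf}\,M_N^{\rm G}(s)\quad(s\in\mathbb R),$$ $$\Xi_N^{\rm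 L}((s,\infty);\zeta)=\prod_{j=1}^N\frac{\pi^{1/2}\,\Gamma(a+j)}{\Gamma(j/2)\,\Gamma(a+(j+1)/2)}\;{\rm Pf}\,M_N^{\rm L}(s/2)\quad(s\ge0,\ a>-1).$$ For odd $N$ the same two formulas hold, with the same prefactors, when $M_N^{\rm G}(s)$, respectively $M_N^{\rm L}(s/2)$, is replaced by the $(N+1)\times(N+1)$ skew-symmetric matrix obtained from it by adding the last column $(\nu_1,\dots,\nu_N,0)^T$ and the last row $(-\nu_1,\dots,-\nu_N,0)$, where $\nu_j=\nu_j^{\rm G}(s)$, respectively $\nu_j=\nu_j^{\rm L}(s/2)$. Here, for a $2n\times2n$ skew-symmetric matrix $A$, ${\rm Pf}\,A=\frac1{2^nn!}\sum_{\sigma\in S_{2n}}{\rm sgn}(\sigma)\prod_{i=1}^nA_{\sigma(2i-1),\sigma(2i)}$. -/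

import Mathlib

open MeasureTheory Set
open scoped BigOperators

noncomputable section

namespace OrthogonalEnsembles

/-! ## Pfaffians -/

/-- The Pfaffian of a (skew-symmetric) matrix of even size `m = 2n`,
`Pf A = (1 / (2 ^ n n!)) ∑_σ sgn σ ∏_{i < n} A (σ (2i)) (σ (2i+1))` (indices from `0`), with the
usual convention that it vanishes for odd `m`. -/
def pfaffian {m : ℕ} (A : Matrix (Fin m) (Fin m) ℂ) : ℂ :=
  if Even m then
    (1 / (2 ^ (m / 2) * (Nat.factorial (m / 2) : ℂ))) *
      ∑ σ : Equiv.Perm (Fin m), ((Equiv.Perm.sign σ : ℤ) : ℂ) *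
        ∏ i : Fin (m / 2),
          A (σ ⟨2 * i.val, by have := i.isLt; omega⟩) (σ ⟨2 * i.val + 1, by have := i.isLt; omega⟩)
  else 0

/-- The skew-symmetric bordering of an `N × N` matrix `A` by an additional last column with entries
`ν 0, …, ν (N-1), 0`, and the corresponding last row `-ν 0, …, -ν (N-1), 0`. -/
def bordered {N : ℕ} (A : Matrix (Fin N) (Fin N) ℂ) (ν : Fin N → ℂ) :
    Matrix (Fin (N + 1)) (Fin (N + 1)) ℂ :=
  Matrix.of fun j k =>
    if hj : j.val < N then
      if hk : k.val < N then A ⟨j.val, hj⟩ ⟨k.val, hk⟩ else ν ⟨j.val, hj⟩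
    else
      if hk : k.val < N then -ν ⟨k.val, hk⟩ else 0

/-! ## Eigenvalue densities and gap probabilities -/

/-- The unnormalised joint eigenvalue density
`∏_l w(x_l) ∏_{j < k} |x_k - x_j|` with one-body weight `w`. -/
def weightProd (w : ℝ → ℝ) (N : ℕ) (x : Fin N → ℝ) : ℝ :=
  (∏ l, w (x l)) * ∏ j, ∏ k ∈ Finset.Ioi j, |x k - x j|

/-- The normalisation constant, that is, the integral of `weightProd` over `ℝ^N`. -/
def partitionFn (w : ℝ → ℝ) (N : ℕ) : ℝ :=
  ∫ x : Fin N → ℝ, weightProd w N x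

/-- The joint eigenvalue law on `ℝ^N`, with density
`(1 / Z_N) ∏_l w(x_l) ∏_{j < k} |x_k - x_j|`. -/
def ensemble (w : ℝ → ℝ) (N : ℕ) : Measure (Fin N → ℝ) :=
  volume.withDensity fun x => ENNReal.ofReal ((1 / partitionFn w N) * weightProd w N x)

/-- One-body weight of the Gaussian orthogonal ensemble. -/
def weightG (x : ℝ) : ℝ := Real.exp (-x ^ 2 / 2)

/-- One-body weight of the Laguerre orthogonal ensemble with parameter `a`. -/
def weightL (a : ℝ) (x : ℝ) : ℝ := if 0 < x then x ^ a * Real.exp (-x / 2) else 0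

/-- `E_N(k; (s, ∞))`: the probability that there are exactly `k` eigenvalues in `(s, ∞)`. -/
def gapProb (w : ℝ → ℝ) (N k : ℕ) (s : ℝ) : ℝ :=
  (ensemble w N).real {x | Set.ncard {l : Fin N | s < x l} = k}

/-- The generating function `Ξ_N((s, ∞); ζ) = ∑_{k=0}^N ζ^k E_N(k; (s, ∞))`. -/
def genFun (w : ℝ → ℝ) (N : ℕ) (s : ℝ) (ζ : ℂ) : ℂ :=
  ∑ k ∈ Finset.range (N + 1), ζ ^ k * (gapProb w N k s : ℂ)

/-! ## Matrix elements, Gaussian case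

The indices `j, k` below are the `1`-based ones; the functions are used only for `j, k ≥ 1`. -/

def H0G (j k : ℕ) (s : ℝ) : ℝ :=
  1 / (Real.Gamma ((j : ℝ) / 2) * Real.Gamma ((k : ℝ) / 2)) *
    ∫ x in Iic s, x ^ (j - 1) * Real.exp (-x ^ 2 / 2) *
      ∫ y in Iic s, y ^ (k - 1) * Real.exp (-y ^ 2 / 2) * Real.sign (y - x)

def H1G (j k : ℕ) (s : ℝ) : ℝ :=
  1 / (Real.Gamma ((j : ℝ) / 2) * Real.Gamma ((k : ℝ) / 2)) *
    ((∫ x in Iic s, x ^ (j - 1) * Real.exp (-x ^ 2 / 2)) *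
        (∫ y in Ioi s, y ^ (k - 1) * Real.exp (-y ^ 2 / 2)) -
      (∫ x in Iic s, x ^ (k - 1) * Real.exp (-x ^ 2 / 2)) *
        (∫ y in Ioi s, y ^ (j - 1) * Real.exp (-y ^ 2 / 2)))

def H2G (j k : ℕ) (s : ℝ) : ℝ :=
  1 / (Real.Gamma ((j : ℝ) / 2) * Real.Gamma ((k : ℝ) / 2)) *
    ∫ x in Ioi s, x ^ (j - 1) * Real.exp (-x ^ 2 / 2) *
      ∫ y in Ioi s, y ^ (k - 1) * Real.exp (-y ^ 2 / 2) * Real.sign (y - x)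

def nuG (ζ : ℂ) (j : ℕ) (s : ℝ) : ℂ :=
  ((1 / Real.Gamma ((j : ℝ) / 2) : ℝ) : ℂ) *
    (((∫ x in Iic s, x ^ (j - 1) * Real.exp (-x ^ 2 / 2) : ℝ) : ℂ) +
      ζ * ((∫ x in Ioi s, x ^ (j - 1) * Real.exp (-x ^ 2 / 2) : ℝ) : ℂ))

/-- The matrix `[H_0(j,k;s) + ζ H_1(j,k;s) + ζ² H_2(j,k;s)]_{j,k=1}^N`, Gaussian case. -/
def matG (N : ℕ) (ζ : ℂ) (s : ℝ) : Matrix (Fin N) (Fin N) ℂ :=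
  Matrix.of fun j k =>
    (H0G (j + 1) (k + 1) s : ℂ) + ζ * (H1G (j + 1) (k + 1) s : ℂ) +
      ζ ^ 2 * (H2G (j + 1) (k + 1) s : ℂ)

/-! ## Matrix elements, Laguerre case with parameter `a` -/

def H0L (a : ℝ) (j k : ℕ) (s : ℝ) : ℝ :=
  1 / (Real.Gamma (a + j) * Real.Gamma (a + k)) *
    ∫ x in (0 : ℝ)..s, x ^ (a + j - 1) * Real.exp (-x) *
      ∫ y in (0 : ℝ)..s, y ^ (a + k - 1) * Real.exp (-y) * Real.sign (y - x)

def H1L (a : ℝ) (j k : ℕ) (s : ℝ) : ℝ :=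
  1 / (Real.Gamma (a + j) * Real.Gamma (a + k)) *
    ((∫ x in (0 : ℝ)..s, x ^ (a + j - 1) * Real.exp (-x)) *
        (∫ y in Ioi s, y ^ (a + k - 1) * Real.exp (-y)) -
      (∫ x in (0 : ℝ)..s, x ^ (a + k - 1) * Real.exp (-x)) *
        (∫ y in Ioi s, y ^ (a + j - 1) * Real.exp (-y)))

def H2L (a : ℝ) (j k : ℕ) (s : ℝ) : ℝ :=
  1 / (Real.Gamma (a + j) * Real.Gamma (a + k)) *
    ∫ x in Ioi s, x ^ (a + j - 1) * Real.exp (-x) *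
      ∫ y in Ioi s, y ^ (a + k - 1) * Real.exp (-y) * Real.sign (y - x)

def nuL (a : ℝ) (ζ : ℂ) (j : ℕ) (s : ℝ) : ℂ :=
  ((1 / Real.Gamma (a + j) : ℝ) : ℂ) *
    (((∫ x in (0 : ℝ)..s, x ^ (a + j - 1) * Real.exp (-x) : ℝ) : ℂ) +
      ζ * ((∫ x in Ioi s, x ^ (a + j - 1) * Real.exp (-x) : ℝ) : ℂ))

/-- The matrix `[H_0(j,k;s) + ζ H_1(j,k;s) + ζ² H_2(j,k;s)]_{j,k=1}^N`, Laguerre case. -/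
def matL (a : ℝ) (N : ℕ) (ζ : ℂ) (s : ℝ) : Matrix (Fin N) (Fin N) ℂ :=
  Matrix.of fun j k =>
    (H0L a (j + 1) (k + 1) s : ℂ) + ζ * (H1L a (j + 1) (k + 1) s : ℂ) +
      ζ ^ 2 * (H2L a (j + 1) (k + 1) s : ℂ)

/-- The prefactor `∏_{j=1}^N √π Γ(a+j) / (Γ(j/2) Γ(a+(j+1)/2))` of the Laguerre case. -/
def constL (a : ℝ) (N : ℕ) : ℝ :=
  ∏ j ∈ Finset.Icc 1 N, Real.sqrt Real.pi * Real.Gamma (a + j) /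
    (Real.Gamma ((j : ℝ) / 2) * Real.Gamma (a + ((j : ℝ) + 1) / 2))

end OrthogonalEnsembles

end

/-!
For a sequence `x`, sorted by the permutation `τ`, the matrix `sgn (x k - x j)` (bordered by ones
in odd size) has Pfaffian `sgn τ`, so `∏ |x k - x j|` is the Vandermonde determinant times this
Pfaffian. De Bruijn's integration formula then turns the average of `∏ markFactor s ζ (x l)` into
a Pfaffian of skew moments.

The normalisation is the same Pfaffian at `ζ = 1`. Let `σ` and `τ` satisfy `(w σ)' = -w τ`. Then
`∫_x^∞ w (τ q - σ q') = w(x) σ(x) q(x)`, which evaluates the skew moments of the polynomials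
`τ q - σ q'` as integrals against the weight `w² σ`. With `q` running over its orthogonal
polynomials, a basis arises in which the moment Pfaffian is an explicit product.
-/

noncomputable section

namespace OrthogonalEnsembles

/-! ## Pfaffian sums over pairs and singles -/

section PfaffianSum

variable {R : Type*} [CommRing R] {α κ ι : Type*}

/-- The permutation of the indices that permutes the pairs by `ρ` and the two members within each
pair by `c`. -/
def pairPerm (e : α × Fin 2 ⊕ κ ≃ ι) (ρ : Equiv.Perm α) (c : Equiv.Perm (Fin 2)) :
    Equiv.Perm ι :=
  e.permCongr (Equiv.sumCongr (Equiv.prodCongr ρ c) (Equiv.refl κ))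

@[simp] lemma pairPerm_inl (e : α × Fin 2 ⊕ κ ≃ ι) (ρ : Equiv.Perm α) (c : Equiv.Perm (Fin 2))
    (p : α × Fin 2) : pairPerm e ρ c (e (.inl p)) = e (.inl (ρ p.1, c p.2)) := by
  simp [pairPerm, Equiv.permCongr_apply, Prod.map]

@[simp] lemma pairPerm_inr (e : α × Fin 2 ⊕ κ ≃ ι) (ρ : Equiv.Perm α) (c : Equiv.Perm (Fin 2))
    (k : κ) : pairPerm e ρ c (e (.inr k)) = e (.inr k) := by
  simp [pairPerm, Equiv.permCongr_apply]

lemma skew_apply_perm {A : Matrix ι ι R} (hA : ∀ j k, A j k = -A k j) (f : Fin 2 → ι)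
    (c : Equiv.Perm (Fin 2)) :
    A (f (c 0)) (f (c 1)) = ((Equiv.Perm.sign c : ℤ) : R) * A (f 0) (f 1) := by
  obtain rfl | rfl : c = 1 ∨ c = Equiv.swap 0 1 := by decide +revert
  · simp
  · simpa using hA (f 1) (f 0)

variable [Fintype α] [Fintype ι] [DecidableEq ι]

lemma sign_mul_sign_self (σ : Equiv.Perm ι) :
    ((Equiv.Perm.sign σ : ℤ) : R) * ((Equiv.Perm.sign σ : ℤ) : R) = 1 := by
  rw [← Int.cast_mul, Int.units_coe_mul_self, Int.cast_one]

lemma sign_pairPerm [Finite κ] (e : α × Fin 2 ⊕ κ ≃ ι) (ρ : Equiv.Perm α) (c : Equiv.Perm (Fin 2)) :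
    Equiv.Perm.sign (pairPerm e ρ c) = Equiv.Perm.sign c ^ Fintype.card α := by
  classical
  have := Fintype.ofFinite κ
  have hprod : Equiv.prodCongr ρ c =
      Equiv.prodCongrLeft (fun _ : Fin 2 => ρ) * Equiv.prodCongrRight (fun _ : α => c) := by
    ext p <;> simp [Equiv.Perm.mul_apply]
  have hsum : Equiv.sumCongr (Equiv.prodCongr ρ c) (Equiv.refl κ) =
      Equiv.Perm.sumCongr (Equiv.prodCongr ρ c) 1 := rfl
  rw [pairPerm, Equiv.Perm.sign_permCongr, hsum, Equiv.Perm.sign_sumCongr, hprod,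
    Equiv.Perm.sign_mul, Equiv.Perm.sign_prodCongrLeft, Equiv.Perm.sign_prodCongrRight]
  simp

lemma sum_perm_eq_card_mul_sum_filter [Finite κ] (e : α × Fin 2 ⊕ κ ≃ ι) {F : Equiv.Perm ι → R}
    (hF : ∀ σ ρ c, F (σ * pairPerm e ρ c) = F σ) {b : ι}
    (hb : ∀ σ k, σ (e (.inr k)) = b → F σ = 0) (p : α × Fin 2) :
    ∑ σ, F σ = 2 * Fintype.card α * ∑ σ with σ (e (.inl p)) = b, F σ := by
  classical
  have := Fintype.ofFinite κ
  have hsplit (σ : Equiv.Perm ι) : F σ = ∑ q, if σ (e q) = b then F σ else 0 := by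
    rw [Fintype.sum_eq_single ((e.trans σ).symm b)]
    · simp
    · intro q hq
      exact if_neg fun h => hq ((Equiv.eq_symm_apply _).2 h)
  have hmove (q : α × Fin 2) : ∑ σ with σ (e (.inl q)) = b, F σ =
      ∑ σ with σ (e (.inl p)) = b, F σ := by
    have hpq := pairPerm_inl e (Equiv.swap q.1 p.1) (Equiv.swap q.2 p.2) q
    rw [Equiv.swap_apply_left, Equiv.swap_apply_left] at hpq
    simp only [Finset.sum_filter]
    rw [← Equiv.sum_comp (Equiv.mulRight (pairPerm e (Equiv.swap q.1 p.1) (Equiv.swap q.2 p.2)))]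
    simp only [Equiv.coe_mulRight, Equiv.Perm.mul_apply, hpq, hF]
  have hsingle (k : κ) : ∑ σ with σ (e (.inr k)) = b, F σ = 0 :=
    Finset.sum_eq_zero fun σ hσ => hb σ k (Finset.mem_filter.1 hσ).2
  calc ∑ σ, F σ = ∑ q, ∑ σ with σ (e q) = b, F σ := by
        simp only [Finset.sum_filter]
        rw [Finset.sum_comm]
        exact Finset.sum_congr rfl fun σ _ => hsplit σ
    _ = 2 * Fintype.card α * ∑ σ with σ (e (.inl p)) = b, F σ := by
        simp [Fintype.sum_sum_type, hmove, hsingle, mul_comm (2 : R)]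

variable [Fintype κ]

/-- The signed monomial of a permutation `σ` in a Pfaffian whose index set is laid out by `e` into
pairs `α × Fin 2`, on which the form `A` is evaluated, and singles `κ`, on which the functional `ν`
is evaluated. One single makes sense of Pfaffians of odd size. -/
def pfTerm (e : α × Fin 2 ⊕ κ ≃ ι) (A : Matrix ι ι R) (ν : ι → R) (σ : Equiv.Perm ι) : R :=
  ((Equiv.Perm.sign σ : ℤ) : R) *
    ((∏ i, A (σ (e (.inl (i, 0)))) (σ (e (.inl (i, 1))))) * ∏ k, ν (σ (e (.inr k))))

/-- The sum of the signed monomials `pfTerm` over all permutations: an unnormalised Pfaffian. -/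
def pfSum (e : α × Fin 2 ⊕ κ ≃ ι) (A : Matrix ι ι R) (ν : ι → R) : R :=
  ∑ σ, pfTerm e A ν σ

lemma pfTerm_comp_perm (e : α × Fin 2 ⊕ κ ≃ ι) (A : Matrix ι ι R) (ν : ι → R) (τ σ : Equiv.Perm ι) :
    pfTerm e (A.submatrix τ τ) (ν ∘ τ) σ =
      ((Equiv.Perm.sign τ : ℤ) : R) * pfTerm e A ν (τ * σ) := by
  simp only [pfTerm, Equiv.Perm.sign_mul, Units.val_mul, Int.cast_mul, Equiv.Perm.mul_apply,
    Matrix.submatrix_apply, Function.comp_apply, ← mul_assoc, sign_mul_sign_self, one_mul]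

lemma pfSum_comp_perm (e : α × Fin 2 ⊕ κ ≃ ι) (A : Matrix ι ι R) (ν : ι → R) (τ : Equiv.Perm ι) :
    pfSum e (A.submatrix τ τ) (ν ∘ τ) = ((Equiv.Perm.sign τ : ℤ) : R) * pfSum e A ν := by
  simp only [pfSum, pfTerm_comp_perm, ← Finset.mul_sum]
  exact congrArg _ (Equiv.sum_comp (Equiv.mulLeft τ) (pfTerm e A ν))

lemma pfSum_scale (e : α × Fin 2 ⊕ κ ≃ ι) (A : Matrix ι ι R) (ν d : ι → R) :
    pfSum e (Matrix.of fun j k => d j * d k * A j k) (fun j => d j * ν j) =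
      (∏ j, d j) * pfSum e A ν := by
  rw [pfSum, pfSum, Finset.mul_sum]
  refine Finset.sum_congr rfl fun σ _ => ?_
  have hd : ∏ j, d j = (∏ i, d (σ (e (.inl (i, 0)))) * d (σ (e (.inl (i, 1))))) *
      ∏ k, d (σ (e (.inr k))) := by
    simp only [← (e.trans σ).prod_comp, Fintype.prod_sum_type, Fintype.prod_prod_type,
      Fin.prod_univ_two, Equiv.trans_apply]
  simp only [pfTerm, hd, Matrix.of_apply, Finset.prod_mul_distrib]
  ring

lemma pfTerm_mul_pairPerm (e : α × Fin 2 ⊕ κ ≃ ι) {A : Matrix ι ι R} (hA : ∀ j k, A j k = -A k j)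
    (ν : ι → R) (σ : Equiv.Perm ι) (ρ : Equiv.Perm α) (c : Equiv.Perm (Fin 2)) :
    pfTerm e A ν (σ * pairPerm e ρ c) = pfTerm e A ν σ := by
  have hpairs : ∏ i, A (σ (e (.inl (ρ i, c 0)))) (σ (e (.inl (ρ i, c 1)))) =
      ((Equiv.Perm.sign c : ℤ) : R) ^ Fintype.card α *
        ∏ i, A (σ (e (.inl (i, 0)))) (σ (e (.inl (i, 1)))) := by
    rw [Equiv.prod_comp ρ fun i => A (σ (e (.inl (i, c 0)))) (σ (e (.inl (i, c 1)))),
      ← Finset.card_univ, ← Finset.prod_const, ← Finset.prod_mul_distrib]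
    exact Finset.prod_congr rfl fun i _ => skew_apply_perm hA (fun b => σ (e (.inl (i, b)))) c
  simp only [pfTerm, Equiv.Perm.mul_apply, pairPerm_inl, pairPerm_inr, hpairs, Equiv.Perm.sign_mul,
    sign_pairPerm, Units.val_mul, Units.val_pow_eq_pow_val, Int.cast_mul, Int.cast_pow]
  have hsign : ((Equiv.Perm.sign c : ℤ) : R) ^ Fintype.card α *
      ((Equiv.Perm.sign c : ℤ) : R) ^ Fintype.card α = 1 := by
    rw [← mul_pow, sign_mul_sign_self, one_pow]
  linear_combination (((Equiv.Perm.sign σ : ℤ) : R) *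
    ((∏ i, A (σ (e (.inl (i, 0)))) (σ (e (.inl (i, 1))))) * ∏ k, ν (σ (e (.inr k))))) * hsign

section Peel

variable (e : α × Fin 2 ⊕ κ ≃ ι) {A : Matrix ι ι R} {ν : ι → R} {a b : ι} {c : R} {r : ι → ι}

lemma pfTerm_eq_mul_of_single (hrb : r b = a) (hr : ∀ x, x ≠ b → r x = x) (hν : ν b = c * ν a)
    {σ : Equiv.Perm ι} {k : κ} (hk : σ (e (.inr k)) = b) :
    pfTerm e A ν σ = c * pfTerm e (A.submatrix r r) (ν ∘ r) σ := by
  classical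
  have hfix {q : α × Fin 2 ⊕ κ} (hq : q ≠ .inr k) : r (σ (e q)) = σ (e q) :=
    hr _ fun h => hq (e.injective (σ.injective (h.trans hk.symm)))
  have hsingles : ∏ k', ν (σ (e (.inr k'))) = c * ∏ k', ν (r (σ (e (.inr k')))) := by
    rw [Fintype.prod_eq_mul_prod_compl k, Fintype.prod_eq_mul_prod_compl k, hk, hrb, hν, mul_assoc]
    refine congrArg _ (congrArg _ (Finset.prod_congr rfl fun k' hk' => ?_))
    rw [hfix fun h => (Finset.mem_compl.1 hk') (Finset.mem_singleton.2 (Sum.inr_injective h))]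
  simp only [pfTerm, Matrix.submatrix_apply, Function.comp_apply, hfix Sum.inl_ne_inr, hsingles]
  ring

lemma pfTerm_eq_mul_of_pair (hA : ∀ j k, A j k = -A k j) (hrb : r b = a)
    (hr : ∀ x, x ≠ b → r x = x) (hAc : ∀ x, x ≠ a → x ≠ b → A b x = c * A a x)
    {σ : Equiv.Perm ι} {i : α} (hia : σ (e (.inl (i, 0))) ≠ a) (hib : σ (e (.inl (i, 1))) = b) :
    pfTerm e A ν σ = c * pfTerm e (A.submatrix r r) (ν ∘ r) σ := by
  classical
  have hfix {q : α × Fin 2 ⊕ κ} (hq : q ≠ .inl (i, 1)) : r (σ (e q)) = σ (e q) :=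
    hr _ fun h => hq (e.injective (σ.injective (h.trans hib.symm)))
  have hne : σ (e (.inl (i, 0))) ≠ b := fun h => by
    simpa using e.injective (σ.injective (h.trans hib.symm))
  have hpair : A (σ (e (.inl (i, 0)))) b = c * A (σ (e (.inl (i, 0)))) a := by
    rw [hA _ b, hA _ a, hAc _ hia hne, mul_neg]
  have hpairs : ∏ j, A (σ (e (.inl (j, 0)))) (σ (e (.inl (j, 1)))) =
      c * ∏ j, A (r (σ (e (.inl (j, 0))))) (r (σ (e (.inl (j, 1))))) := by
    rw [Fintype.prod_eq_mul_prod_compl i, Fintype.prod_eq_mul_prod_compl i, hib, hrb,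
      hfix (by simp), hpair, mul_assoc]
    refine congrArg _ (congrArg _ (Finset.prod_congr rfl fun j hj => ?_))
    have hji : j ≠ i := fun h => (Finset.mem_compl.1 hj) (Finset.mem_singleton.2 h)
    rw [hfix (by simp), hfix (by simpa using hji)]
  simp only [pfTerm, Matrix.submatrix_apply, Function.comp_apply, hfix Sum.inr_ne_inl, hpairs]
  ring

lemma sum_pfTerm_eq_zero (hab : a ≠ b) (hr : r ∘ Equiv.swap a b = r) :
    ∑ σ, pfTerm e (A.submatrix r r) (ν ∘ r) σ = 0 := by
  have hanti (σ : Equiv.Perm ι) :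
      pfTerm e (A.submatrix r r) (ν ∘ r) σ +
        pfTerm e (A.submatrix r r) (ν ∘ r) (Equiv.swap a b * σ) = 0 := by
    have h := pfTerm_comp_perm e (A.submatrix r r) (ν ∘ r) (Equiv.swap a b) σ
    rw [Matrix.submatrix_submatrix, Function.comp_assoc, hr, Equiv.Perm.sign_swap hab] at h
    simp [h]
  refine Finset.sum_involution (fun σ _ => Equiv.swap a b * σ) (fun σ _ => hanti σ) ?_
    (fun _ _ => Finset.mem_univ _) fun σ _ => Equiv.swap_mul_self_mul a b σ
  exact fun σ _ _ h => hab (Equiv.swap_eq_one_iff.1 (mul_eq_right.1 h))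

/-- If the row of `b` is `c` times that of `a`, apart from the entries at `a` and `b` themselves,
only the monomials in which `a` and `b` are paired survive: subtracting `c` times the Pfaffian sum
with `b` replaced by `a`, which is zero, cancels all others. -/
lemma pfSum_eq_sum_paired (hA : ∀ j k, A j k = -A k j) (hdiag : A a a = 0) (hab : a ≠ b)
    (hAc : ∀ x, x ≠ a → x ≠ b → A b x = c * A a x) (hν : ν b = c * ν a) (i : α) :
    pfSum e A ν = 2 * Fintype.card α *
      ∑ σ with σ (e (.inl (i, 0))) = a ∧ σ (e (.inl (i, 1))) = b, pfTerm e A ν σ := by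
  set r := Function.update id b a with hrdef
  have hrb : r b = a := by simp [hrdef]
  have hr (x : ι) (hx : x ≠ b) : r x = x := by simp [hrdef, hx]
  set G := pfTerm e (A.submatrix r r) (ν ∘ r)
  have hH := sum_perm_eq_card_mul_sum_filter e (F := fun σ => pfTerm e A ν σ - c * G σ)
    (fun σ ρ c' => by
      simp only [G, pfTerm_mul_pairPerm e hA,
        pfTerm_mul_pairPerm e (A := A.submatrix r r) fun j k => hA (r j) (r k)])
    (b := b) (fun σ k hk => sub_eq_zero.2 (pfTerm_eq_mul_of_single e hrb hr hν hk)) (i, 1)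
  have hpaired (σ : Equiv.Perm ι) (hσ : σ (e (.inl (i, 1))) = b) :
      pfTerm e A ν σ - c * G σ = if σ (e (.inl (i, 0))) = a then pfTerm e A ν σ else 0 := by
    split_ifs with ha
    · have hG : G σ = 0 := by
        have : ∏ j, A (r (σ (e (.inl (j, 0))))) (r (σ (e (.inl (j, 1))))) = 0 :=
          Finset.prod_eq_zero (Finset.mem_univ i) (by rw [ha, hσ, hrb, hr a hab, hdiag])
        simp [G, pfTerm, this]
      rw [hG, mul_zero, sub_zero]
    · exact sub_eq_zero.2 (pfTerm_eq_mul_of_pair e hA hrb hr hAc ha hσ)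
  have hr_swap : r ∘ Equiv.swap a b = r := by
    ext x
    rcases eq_or_ne x a with rfl | hxa
    · simp [hrb, hr _ hab]
    rcases eq_or_ne x b with rfl | hxb
    · simp [hrb, hr _ hab]
    · simp [Equiv.swap_apply_of_ne_of_ne hxa hxb]
  rw [Finset.sum_sub_distrib, ← Finset.mul_sum, sum_pfTerm_eq_zero e hab hr_swap, mul_zero,
    sub_zero] at hH
  rw [pfSum, hH, Finset.sum_congr rfl fun σ hσ => hpaired σ (Finset.mem_filter.1 hσ).2,
    ← Finset.sum_filter, Finset.filter_filter]
  simp only [and_comm]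

end Peel

end PfaffianSum

section Layout

variable {m r N : ℕ}

/-- The layout of `N = r + 2 * m` consecutive indices: the first `r` of them are singles, and the
remaining ones form `m` pairs of neighbours. -/
def layout (h : r + 2 * m = N) : Fin m × Fin 2 ⊕ Fin r ≃ Fin N :=
  (((Equiv.sumComm _ _).trans ((Equiv.refl _).sumCongr finProdFinEquiv)).trans
    finSumFinEquiv).trans (finCongr (by omega))

@[simp] lemma layout_inl_val (h : r + 2 * m = N) (i : Fin m) (b : Fin 2) :
    (layout h (.inl (i, b)) : ℕ) = r + 2 * i + b := by
  simp [layout, finProdFinEquiv]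
  ring

@[simp] lemma layout_inr_val (h : r + 2 * m = N) (k : Fin r) :
    (layout h (.inr k) : ℕ) = k := by
  simp [layout]

/-- The extension of a permutation of the first `N` indices by the last index. -/
def borderPerm (σ : Equiv.Perm (Fin N)) : Equiv.Perm (Fin (N + 1)) :=
  finSuccEquivLast.symm.permCongr σ.optionCongr

@[simp] lemma borderPerm_castSucc (σ : Equiv.Perm (Fin N)) (j : Fin N) :
    borderPerm σ j.castSucc = (σ j).castSucc := by
  simp [borderPerm, Equiv.permCongr_apply]

@[simp] lemma borderPerm_last (σ : Equiv.Perm (Fin N)) :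
    borderPerm σ (Fin.last N) = Fin.last N := by
  simp [borderPerm, Equiv.permCongr_apply]

@[simp] lemma sign_borderPerm (σ : Equiv.Perm (Fin N)) :
    Equiv.Perm.sign (borderPerm σ) = Equiv.Perm.sign σ := by
  rw [borderPerm, Equiv.Perm.sign_permCongr, Equiv.optionCongr_sign]

lemma borderPerm_injective : Function.Injective (borderPerm (N := N)) := fun σ τ h => by
  ext j
  have := congrArg (fun ρ : Equiv.Perm (Fin (N + 1)) => (ρ j.castSucc : ℕ)) h
  simpa using this

lemma exists_borderPerm_eq {σ : Equiv.Perm (Fin (N + 1))} (hσ : σ (Fin.last N) = Fin.last N) :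
    ∃ τ, borderPerm τ = σ := by
  refine ⟨Equiv.removeNone (finSuccEquivLast.permCongr σ), ?_⟩
  have h : (finSuccEquivLast.permCongr σ) none = none := by simp [Equiv.permCongr_apply, hσ]
  rw [borderPerm, map_equiv_removeNone, h]
  ext
  simp [Equiv.permCongr_apply]

lemma sum_filter_last_eq {R : Type*} [AddCommMonoid R] (f : Equiv.Perm (Fin (N + 1)) → R) :
    ∑ σ with σ (Fin.last N) = Fin.last N, f σ = ∑ τ, f (borderPerm τ) := by
  refine (Finset.sum_bij (fun τ _ => borderPerm τ) (by simp)
    (fun _ _ _ _ h => borderPerm_injective h) (fun σ hσ => ?_) fun _ _ => rfl).symm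
  obtain ⟨τ, rfl⟩ := exists_borderPerm_eq (Finset.mem_filter.1 hσ).2
  exact ⟨τ, Finset.mem_univ _, rfl⟩

variable {R : Type*} [CommRing R]

lemma layout_last_pair (h : r + 2 * (m + 1) = N + 2) :
    layout h (.inl (Fin.last m, 0)) = (Fin.last N).castSucc ∧
      layout h (.inl (Fin.last m, 1)) = Fin.last (N + 1) := by
  constructor <;> ext <;> simp <;> omega

lemma pfTerm_borderPerm_borderPerm (h : r + 2 * m = N) (h' : r + 2 * (m + 1) = N + 2)
    (A : Matrix ℕ ℕ R) (ν : ℕ → R) (τ : Equiv.Perm (Fin N)) :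
    pfTerm (layout h') (A.submatrix Fin.val Fin.val) (ν ∘ Fin.val)
        (borderPerm (borderPerm τ)) =
      A N (N + 1) * pfTerm (layout h) (A.submatrix Fin.val Fin.val) (ν ∘ Fin.val) τ := by
  have hpair (i : Fin m) (b : Fin 2) :
      layout h' (.inl (i.castSucc, b)) = (layout h (.inl (i, b))).castSucc.castSucc := by
    ext; simp
  have hsingle (k : Fin r) : layout h' (.inr k) = (layout h (.inr k)).castSucc.castSucc := by
    ext; simp
  simp only [pfTerm, Matrix.submatrix_apply, Function.comp_apply, sign_borderPerm,
    Fin.prod_univ_castSucc, hpair, hsingle, layout_last_pair h', borderPerm_castSucc,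
    borderPerm_last, Fin.val_castSucc, Fin.val_last]
  ring

lemma pfSum_add_two (h : r + 2 * m = N) (h' : r + 2 * (m + 1) = N + 2) {A : Matrix ℕ ℕ R}
    {ν : ℕ → R} (hA : ∀ j k, A j k = -A k j) (hdiag : A N N = 0) {c : R}
    (hAc : ∀ j < N, A (N + 1) j = c * A N j) (hν : ν (N + 1) = c * ν N) :
    pfSum (layout h') (A.submatrix Fin.val Fin.val) (ν ∘ Fin.val) =
      2 * (m + 1) * A N (N + 1) * pfSum (layout h) (A.submatrix Fin.val Fin.val) (ν ∘ Fin.val) := by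
  obtain ⟨h0, h1⟩ := layout_last_pair h'
  have hne : (Fin.last N).castSucc ≠ Fin.last (N + 1) := Fin.castSucc_ne_last _
  rw [pfSum_eq_sum_paired (layout h') (A := A.submatrix Fin.val Fin.val) (fun j k => hA j k)
    (a := (Fin.last N).castSucc) (b := Fin.last (N + 1)) (c := c) hdiag hne ?_ hν (Fin.last m)]
  · have hinner (σ : Equiv.Perm (Fin (N + 1))) :
        borderPerm σ (Fin.last N).castSucc = (Fin.last N).castSucc ↔
          σ (Fin.last N) = Fin.last N := by
      rw [borderPerm_castSucc, Fin.castSucc_inj]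
    simp only [h0, h1, and_comm (b := _ = Fin.last (N + 1)), ← Finset.filter_filter]
    rw [Finset.sum_filter, sum_filter_last_eq]
    simp only [hinner, ← Finset.sum_filter, sum_filter_last_eq,
      pfTerm_borderPerm_borderPerm h h', ← Finset.mul_sum]
    simp only [pfSum, Fintype.card_fin, Nat.cast_add, Nat.cast_one]
    ring
  · intro j ha hb
    refine hAc j ?_
    have := Fin.val_ne_of_ne ha
    have := Fin.val_ne_of_ne hb
    simp only [Fin.val_castSucc, Fin.val_last] at *
    omega

lemma pfSum_eq_of_chain (hr : r < 2) (h : r + 2 * m = N) {A : Matrix ℕ ℕ R} {ν c g : ℕ → R}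
    (hA : ∀ j k, A j k = -A k j) (hdiag : ∀ n, A n n = 0)
    (hAc : ∀ n, ∀ j < n, A (n + 1) j = c n * A n j) (hν : ∀ n, ν (n + 1) = c n * ν n)
    (hAg : ∀ n, A n (n + 1) = g n * g (n + 1)) (hν0 : ν 0 = g 0) :
    pfSum (layout h) (A.submatrix Fin.val Fin.val) (ν ∘ Fin.val) =
      2 ^ m * m.factorial * ∏ j ∈ Finset.range N, g j := by
  induction m generalizing N with
  | zero =>
    subst h
    interval_cases r
    · simp [pfSum, pfTerm]
    · simp [pfSum, pfTerm, hν0]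
  | succ m ih =>
    obtain ⟨n, rfl⟩ : ∃ n, N = n + 2 := ⟨r + 2 * m, by omega⟩
    rw [pfSum_add_two (by omega) h hA (hdiag n) (hAc n) (hν n), hAg, ih (by omega),
      Finset.prod_range_succ, Finset.prod_range_succ, Nat.factorial_succ]
    push_cast
    ring

end Layout

section Bordered

variable {N : ℕ} (A : Matrix (Fin N) (Fin N) ℂ) (ν : Fin N → ℂ)

@[simp] lemma bordered_castSucc_castSucc (j k : Fin N) :
    bordered A ν j.castSucc k.castSucc = A j k := by simp [bordered]

@[simp] lemma bordered_castSucc_last (j : Fin N) :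
    bordered A ν j.castSucc (Fin.last N) = ν j := by simp [bordered]

@[simp] lemma bordered_last_castSucc (k : Fin N) :
    bordered A ν (Fin.last N) k.castSucc = -ν k := by simp [bordered]

@[simp] lemma bordered_last_last : bordered A ν (Fin.last N) (Fin.last N) = 0 := by
  simp [bordered]

variable {A}

lemma bordered_skew (hA : ∀ j k, A j k = -A k j) (j k : Fin (N + 1)) :
    bordered A ν j k = -bordered A ν k j := by
  induction j using Fin.lastCases with
  | last => induction k using Fin.lastCases <;> simp
  | cast j =>
    induction k using Fin.lastCases with
    | last => simp
    | cast k => simpa using hA j k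

lemma pfTerm_bordered_rotate {m : ℕ} (h : 1 + 2 * m = N) (h' : 0 + 2 * (m + 1) = N + 1)
    (ν' : Fin (N + 1) → ℂ) (τ : Equiv.Perm (Fin N)) :
    pfTerm (layout h') (bordered A ν) ν' (borderPerm τ * (finRotate (N + 1))⁻¹) =
      pfTerm (layout h) A ν τ := by
  have hrot (j : Fin N) : (finRotate (N + 1))⁻¹ j.succ = j.castSucc := by
    rw [Equiv.Perm.inv_eq_iff_eq, finRotate_apply, Fin.coeSucc_eq_succ]
  have hrot0 : (finRotate (N + 1))⁻¹ 0 = Fin.last N := by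
    rw [Equiv.Perm.inv_eq_iff_eq, finRotate_last]
  have h00 : layout h' (.inl (0, 0)) = 0 := by ext; simp
  have h01 : layout h' (.inl (0, 1)) = (layout h (.inr 0)).succ := by ext; simp
  have hpair (i : Fin m) (b : Fin 2) :
      layout h' (.inl (i.succ, b)) = (layout h (.inl (i, b))).succ := by
    ext; simp; ring
  have hsign : Equiv.Perm.sign (finRotate (N + 1)) = -1 := by
    rw [sign_finRotate, Nat.add_sub_cancel, Odd.neg_one_pow ⟨m, by omega⟩]
  simp only [pfTerm, Equiv.Perm.sign_mul, Equiv.Perm.sign_inv, hsign, sign_borderPerm,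
    Fin.prod_univ_succ, h00, h01, hpair, Equiv.Perm.mul_apply, hrot, hrot0, borderPerm_castSucc,
    borderPerm_last, bordered_castSucc_castSucc, bordered_last_castSucc]
  simp
  ring

lemma pfSum_bordered (hA : ∀ j k, A j k = -A k j) {m : ℕ} (h : 1 + 2 * m = N)
    (h' : 0 + 2 * (m + 1) = N + 1) (ν' : Fin (N + 1) → ℂ) :
    pfSum (layout h') (bordered A ν) ν' = 2 * (m + 1) * pfSum (layout h) A ν := by
  have hmove (σ : Equiv.Perm (Fin (N + 1))) :
      (σ * (finRotate (N + 1))⁻¹) (layout h' (.inl (0, 0))) = σ (Fin.last N) := by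
    have h00 : layout h' (.inl (0, 0)) = 0 := by ext; simp
    rw [Equiv.Perm.mul_apply, h00, (Equiv.Perm.inv_eq_iff_eq).2 (finRotate_last).symm]
  rw [pfSum, sum_perm_eq_card_mul_sum_filter (layout h') (b := Fin.last N)
    (pfTerm_mul_pairPerm _ (bordered_skew ν hA) ν') (fun _ k => k.elim0) (0, 0), Finset.sum_filter,
    ← Equiv.sum_comp (Equiv.mulRight (finRotate (N + 1))⁻¹)]
  simp only [Equiv.coe_mulRight, hmove, ← Finset.sum_filter, sum_filter_last_eq,
    pfTerm_bordered_rotate ν h h', pfSum, Fintype.card_fin, Nat.cast_add, Nat.cast_one]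

lemma pfaffian_eq_pfSum {m : ℕ} (h : 0 + 2 * m = N) :
    pfaffian A = 1 / (2 ^ m * m.factorial) * pfSum (layout h) A ν := by
  obtain rfl : N = 2 * m := by omega
  have hm : 2 * m / 2 = m := by omega
  rw [pfaffian, if_pos (even_two_mul m)]
  simp only [pfSum, pfTerm, hm, Finset.univ_eq_empty, Finset.prod_empty, mul_one]
  refine congrArg _ (Finset.sum_congr rfl fun σ _ => congrArg _ ?_)
  refine Fintype.prod_equiv (finCongr hm) _ _ fun i => ?_
  congr 2 <;> ext <;> simp

variable (A) in
/-- The Pfaffian of `A` if the size `N` is even and of `A` bordered by `ν` if it is odd, so that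
both cases of the theorem concern the same quantity. -/
def completedPfaffian : ℂ :=
  if Even N then pfaffian A else pfaffian (bordered A ν)

lemma completedPfaffian_eq (hA : ∀ j k, A j k = -A k j) {r m : ℕ} (hr : r < 2)
    (h : r + 2 * m = N) :
    completedPfaffian A ν = 1 / (2 ^ m * m.factorial) * pfSum (layout h) A ν := by
  interval_cases r
  · rw [completedPfaffian, if_pos ⟨m, by omega⟩, pfaffian_eq_pfSum ν h]
  · have hodd : ¬ Even N := Nat.not_even_iff_odd.2 ⟨m, by omega⟩
    have h' : 0 + 2 * (m + 1) = N + 1 := by omega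
    rw [completedPfaffian, if_neg hodd, pfaffian_eq_pfSum 0 h', pfSum_bordered ν hA h h',
      Nat.factorial_succ]
    have : (m : ℂ) + 1 ≠ 0 := by exact_mod_cast m.succ_ne_zero
    have : (m.factorial : ℂ) ≠ 0 := by exact_mod_cast m.factorial_ne_zero
    push_cast
    field_simp
    ring

lemma exists_layout (N : ℕ) : ∃ r m : ℕ, r < 2 ∧ r + 2 * m = N :=
  ⟨N % 2, N / 2, Nat.mod_lt _ two_pos, Nat.mod_add_div N 2⟩

lemma completedPfaffian_scale (hA : ∀ j k, A j k = -A k j) (d : Fin N → ℂ) :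
    completedPfaffian (Matrix.of fun j k => d j * d k * A j k) (fun j => d j * ν j) =
      (∏ j, d j) * completedPfaffian A ν := by
  obtain ⟨r, m, hr, h⟩ := exists_layout N
  have hskew (j k : Fin N) : d j * d k * A j k = -(d k * d j * A k j) := by rw [hA j k]; ring
  rw [completedPfaffian_eq (A := Matrix.of fun j k => d j * d k * A j k) _ hskew hr h,
    completedPfaffian_eq _ hA hr h, pfSum_scale]
  ring

lemma completedPfaffian_of_chain {A : Matrix ℕ ℕ ℂ} {ν c g : ℕ → ℂ}
    (hA : ∀ j k, A j k = -A k j) (hAc : ∀ n, ∀ j < n, A (n + 1) j = c n * A n j)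
    (hν : ∀ n, ν (n + 1) = c n * ν n) (hAg : ∀ n, A n (n + 1) = g n * g (n + 1))
    (hν0 : ν 0 = g 0) :
    completedPfaffian (A.submatrix Fin.val Fin.val) (ν ∘ Fin.val : Fin N → ℂ) =
      ∏ j ∈ Finset.range N, g j := by
  obtain ⟨r, m, hr, h⟩ := exists_layout N
  have hdiag (n : ℕ) : A n n = 0 := self_eq_neg.1 (hA n n)
  have : (m.factorial : ℂ) ≠ 0 := by exact_mod_cast m.factorial_ne_zero
  rw [completedPfaffian_eq (A := A.submatrix Fin.val Fin.val) _ (fun j k => hA j k) hr h,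
    pfSum_eq_of_chain hr h hA hdiag hAc hν hAg hν0]
  field_simp

end Bordered

/-! ## De Bruijn's integration formula -/

section Kernel

variable {α κ ι X : Type*} [Fintype α] [Fintype κ] [Fintype ι] [DecidableEq ι]

/-- The summand of the identity permutation in the product of `det [φ j (x l)]` and the Pfaffian sum
of the matrix `ε (x j, x k)`, with border `η (x j)`. -/
def deBruijnKernel (e : α × Fin 2 ⊕ κ ≃ ι) (φ : ι → X → ℂ) (ε : X × X → ℂ) (η : X → ℂ)
    (x : ι → X) : ℂ :=
  (Matrix.of fun j l => φ j (x l)).det *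
    ((∏ i, ε (x (e (.inl (i, 0))), x (e (.inl (i, 1))))) * ∏ k, η (x (e (.inr k))))

variable (e : α × Fin 2 ⊕ κ ≃ ι) (φ : ι → X → ℂ) (ε : X × X → ℂ) (η : X → ℂ)

lemma det_mul_pfSum_eq_sum_kernel (x : ι → X) :
    (Matrix.of fun j l => φ j (x l)).det *
        pfSum e (Matrix.of fun j k => ε (x j, x k)) (fun j => η (x j)) =
      ∑ σ : Equiv.Perm ι, deBruijnKernel e φ ε η (x ∘ σ) := by
  rw [pfSum, Finset.mul_sum]
  refine Finset.sum_congr rfl fun σ _ => ?_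
  have hdet : (Matrix.of fun j l => φ j ((x ∘ σ) l)).det =
      ((Equiv.Perm.sign σ : ℤ) : ℂ) * (Matrix.of fun j l => φ j (x l)).det :=
    Matrix.det_permute' σ (Matrix.of fun j l => φ j (x l))
  rw [deBruijnKernel, hdet]
  simp only [pfTerm, Matrix.of_apply, Function.comp_apply]
  ring

lemma deBruijnKernel_eq_sum (x : ι → X) :
    deBruijnKernel e φ ε η x = ∑ τ : Equiv.Perm ι, ((Equiv.Perm.sign τ : ℤ) : ℂ) *
      ((∏ i, φ (τ (e (.inl (i, 0)))) (x (e (.inl (i, 0)))) *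
          φ (τ (e (.inl (i, 1)))) (x (e (.inl (i, 1)))) *
            ε (x (e (.inl (i, 0))), x (e (.inl (i, 1))))) *
        ∏ k, φ (τ (e (.inr k))) (x (e (.inr k))) * η (x (e (.inr k)))) := by
  rw [deBruijnKernel, Matrix.det_apply', Finset.sum_mul]
  refine Finset.sum_congr rfl fun τ _ => ?_
  simp only [Matrix.of_apply, ← e.prod_comp, Fintype.prod_sum_type, Fintype.prod_prod_type,
    Fin.prod_univ_two, Finset.prod_mul_distrib]
  ring

end Kernel

section DeBruijn

variable {α κ ι X : Type*} [MeasurableSpace X]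

/-- The assembly of a configuration indexed by `ι` from pairs and singles laid out by `e`. -/
def layoutMeasurableEquiv (e : α × Fin 2 ⊕ κ ≃ ι) : (α → X × X) × (κ → X) ≃ᵐ (ι → X) :=
  ((((MeasurableEquiv.arrowProdEquivProdArrow X X α).trans
    (MeasurableEquiv.sumPiEquivProdPi fun _ : α ⊕ α => X).symm).prodCongr
      (MeasurableEquiv.refl (κ → X))).trans
    (MeasurableEquiv.sumPiEquivProdPi fun _ : (α ⊕ α) ⊕ κ => X).symm).trans
      (MeasurableEquiv.piCongrLeft (fun _ => X)
        ((((Equiv.boolProdEquivSum α).symm.trans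
          ((finTwoEquiv.symm.prodCongr (Equiv.refl α)).trans (Equiv.prodComm _ _))).sumCongr
            (Equiv.refl κ)).trans e))

lemma layoutMeasurableEquiv_inl_zero (e : α × Fin 2 ⊕ κ ≃ ι) (p : (α → X × X) × (κ → X)) (i : α) :
    layoutMeasurableEquiv e p (e (.inl (i, 0))) = (p.1 i).1 :=
  Equiv.piCongrLeft_apply_apply (fun _ : ι => X) _ _ (Sum.inl (Sum.inl i))

lemma layoutMeasurableEquiv_inl_one (e : α × Fin 2 ⊕ κ ≃ ι) (p : (α → X × X) × (κ → X)) (i : α) :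
    layoutMeasurableEquiv e p (e (.inl (i, 1))) = (p.1 i).2 :=
  Equiv.piCongrLeft_apply_apply (fun _ : ι => X) _ _ (Sum.inl (Sum.inr i))

lemma layoutMeasurableEquiv_inr (e : α × Fin 2 ⊕ κ ≃ ι) (p : (α → X × X) × (κ → X)) (k : κ) :
    layoutMeasurableEquiv e p (e (.inr k)) = p.2 k :=
  Equiv.piCongrLeft_apply_apply (fun _ : ι => X) _ _ (Sum.inr k)

variable [Fintype α] [Fintype κ] [Fintype ι] (μ : Measure X) [SigmaFinite μ]

lemma measurePreserving_layoutMeasurableEquiv (e : α × Fin 2 ⊕ κ ≃ ι) :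
    MeasurePreserving (layoutMeasurableEquiv (X := X) e)
      ((Measure.pi fun _ => μ.prod μ).prod (Measure.pi fun _ => μ)) (Measure.pi fun _ => μ) :=
  ((measurePreserving_piCongrLeft (fun _ => μ) _).comp
    (measurePreserving_sumPiEquivProdPi_symm fun _ => μ)).comp
      (((measurePreserving_sumPiEquivProdPi_symm fun _ => μ).comp
        (measurePreserving_arrowProdEquivProdArrow X X α (fun _ => μ) fun _ => μ)).prod
          (MeasurePreserving.id _))

variable {μ}

lemma integrable_prod_pairs_mul_prod_singles (e : α × Fin 2 ⊕ κ ≃ ι) {ψ : α → X × X → ℂ}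
    {χ : κ → X → ℂ} (hψ : ∀ i, Integrable (ψ i) (μ.prod μ)) (hχ : ∀ k, Integrable (χ k) μ) :
    Integrable (fun x : ι → X => (∏ i, ψ i (x (e (.inl (i, 0))), x (e (.inl (i, 1))))) *
      ∏ k, χ k (x (e (.inr k)))) (Measure.pi fun _ => μ) := by
  rw [← (measurePreserving_layoutMeasurableEquiv μ e).integrable_comp_emb
    (MeasurableEquiv.measurableEmbedding _)]
  simp only [Function.comp_def, layoutMeasurableEquiv_inl_zero, layoutMeasurableEquiv_inl_one,
    layoutMeasurableEquiv_inr, Prod.mk.eta]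
  exact (Integrable.fintype_prod hψ).mul_prod (Integrable.fintype_prod hχ)

lemma integral_prod_pairs_mul_prod_singles (e : α × Fin 2 ⊕ κ ≃ ι) (ψ : α → X × X → ℂ)
    (χ : κ → X → ℂ) :
    ∫ x : ι → X, (∏ i, ψ i (x (e (.inl (i, 0))), x (e (.inl (i, 1))))) *
      ∏ k, χ k (x (e (.inr k))) ∂(Measure.pi fun _ => μ) =
    (∏ i, ∫ p, ψ i p ∂(μ.prod μ)) * ∏ k, ∫ t, χ k t ∂μ := by
  rw [← (measurePreserving_layoutMeasurableEquiv μ e).integral_comp'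
    (f := layoutMeasurableEquiv e)]
  simp only [layoutMeasurableEquiv_inl_zero, layoutMeasurableEquiv_inl_one,
    layoutMeasurableEquiv_inr, Prod.mk.eta]
  rw [integral_prod_mul (fun p : α → X × X => ∏ i, ψ i (p i)) fun t : κ → X => ∏ k, χ k (t k),
    integral_fintype_prod_eq_prod, integral_fintype_prod_eq_prod]

variable [DecidableEq ι] {φ : ι → X → ℂ} {ε : X × X → ℂ} {η : X → ℂ} (e : α × Fin 2 ⊕ κ ≃ ι)
variable (hε : ∀ j k, Integrable (fun p => φ j p.1 * φ k p.2 * ε p) (μ.prod μ))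
  (hη : ∀ j, Integrable (fun t => φ j t * η t) μ)

include hε hη

lemma integrable_deBruijnKernel :
    Integrable (deBruijnKernel e φ ε η) (Measure.pi fun _ => μ) := by
  simp only [funext fun x => deBruijnKernel_eq_sum e φ ε η x]
  exact integrable_finsetSum _ fun τ _ =>
    (integrable_prod_pairs_mul_prod_singles e (fun _ => hε _ _) fun _ => hη _).const_mul _

lemma integral_deBruijnKernel :
    ∫ x, deBruijnKernel e φ ε η x ∂(Measure.pi fun _ => μ) =
      pfSum e (Matrix.of fun j k => ∫ p, φ j p.1 * φ k p.2 * ε p ∂(μ.prod μ))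
        (fun j => ∫ t, φ j t * η t ∂μ) := by
  simp only [deBruijnKernel_eq_sum]
  rw [integral_finsetSum _ fun τ _ =>
    (integrable_prod_pairs_mul_prod_singles e (fun _ => hε _ _) fun _ => hη _).const_mul _]
  refine Finset.sum_congr rfl fun τ _ => ?_
  rw [integral_const_mul]
  exact congrArg _ (integral_prod_pairs_mul_prod_singles e
    (fun i p => φ (τ (e (.inl (i, 0)))) p.1 * φ (τ (e (.inl (i, 1)))) p.2 * ε p)
    fun k t => φ (τ (e (.inr k))) t * η t)

theorem integral_det_mul_pfSum :
    ∫ x, (Matrix.of fun j l => φ j (x l)).det *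
        pfSum e (Matrix.of fun j k => ε (x j, x k)) (fun j => η (x j)) ∂(Measure.pi fun _ => μ) =
      (Fintype.card ι).factorial *
        pfSum e (Matrix.of fun j k => ∫ p, φ j p.1 * φ k p.2 * ε p ∂(μ.prod μ))
          (fun j => ∫ t, φ j t * η t ∂μ) := by
  have hperm (σ : Equiv.Perm ι) : MeasurePreserving
      (MeasurableEquiv.arrowCongr' σ.symm (MeasurableEquiv.refl X))
      (Measure.pi fun _ => μ) (Measure.pi fun _ => μ) :=
    measurePreserving_arrowCongr' (fun _ => μ) (fun _ => μ) σ.symm (MeasurableEquiv.refl X)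
      fun _ => MeasurePreserving.id μ
  have hint (σ : Equiv.Perm ι) : Integrable (fun x => deBruijnKernel e φ ε η (x ∘ σ))
      (Measure.pi fun _ => μ) :=
    (hperm σ).integrable_comp_of_integrable (integrable_deBruijnKernel e hε hη)
  have hcomp (σ : Equiv.Perm ι) : ∫ x, deBruijnKernel e φ ε η (x ∘ σ) ∂(Measure.pi fun _ => μ) =
      ∫ x, deBruijnKernel e φ ε η x ∂(Measure.pi fun _ => μ) :=
    (hperm σ).integral_comp' (deBruijnKernel e φ ε η)
  simp only [det_mul_pfSum_eq_sum_kernel]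
  rw [integral_finsetSum _ fun σ _ => hint σ, ← integral_deBruijnKernel e hε hη,
    Finset.sum_congr rfl fun σ _ => hcomp σ, Finset.sum_const, Finset.card_univ,
    Fintype.card_perm, nsmul_eq_mul]

end DeBruijn

/-! ## The absolute value of the Vandermonde determinant -/

section Vandermonde

variable {N : ℕ}

lemma completedPfaffian_comp_perm {A : Matrix (Fin N) (Fin N) ℂ} (ν : Fin N → ℂ)
    (hA : ∀ j k, A j k = -A k j) (σ : Equiv.Perm (Fin N)) :
    completedPfaffian (A.submatrix σ σ) (ν ∘ σ) =
      ((Equiv.Perm.sign σ : ℤ) : ℂ) * completedPfaffian A ν := by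
  obtain ⟨r, m, hr, h⟩ := exists_layout N
  rw [completedPfaffian_eq (A := A.submatrix σ σ) _ (fun j k => hA _ _) hr h,
    completedPfaffian_eq ν hA hr h, pfSum_comp_perm]
  ring

/-- The matrix `sgn (x k - x j)`, whose Pfaffian is the sign of the permutation sorting `x`. -/
def signMatrix (x : Fin N → ℝ) : Matrix (Fin N) (Fin N) ℂ :=
  Matrix.of fun j k => ((Real.sign (x k - x j) : ℝ) : ℂ)

lemma signMatrix_skew (x : Fin N → ℝ) (j k : Fin N) : signMatrix x j k = -signMatrix x k j := by
  simp only [signMatrix, Matrix.of_apply, ← Complex.ofReal_neg, ← Real.sign_neg, neg_sub]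

lemma completedPfaffian_signMatrix_of_strictMono {x : Fin N → ℝ} (hx : StrictMono x) :
    completedPfaffian (signMatrix x) 1 = 1 := by
  have hsign : signMatrix x =
      Matrix.submatrix (Matrix.of fun j k : ℕ => ((Real.sign ((k : ℝ) - j) : ℝ) : ℂ))
        Fin.val Fin.val := by
    ext j k
    rcases lt_trichotomy j k with h | rfl | h
    · simp [signMatrix, Real.sign_of_pos, hx h, h]
    · simp [signMatrix]
    · simp [signMatrix, Real.sign_of_neg, hx h, h]
  rw [hsign, ← Finset.prod_const_one (M := ℂ) (s := Finset.range N)]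
  refine completedPfaffian_of_chain (ν := fun _ => 1) (c := fun _ => 1) (g := fun _ => 1)
    (fun j k => ?_) (fun n j hj => ?_) (fun _ => by simp) (fun _ => by simp [Real.sign_of_pos]) rfl
  · simp only [Matrix.of_apply, ← Complex.ofReal_neg, ← Real.sign_neg, neg_sub]
  · have hj' : (j : ℝ) < n := by exact_mod_cast hj
    have hj'' : (j : ℝ) < (n + 1 : ℕ) := by exact_mod_cast hj.trans n.lt_succ_self
    simp only [Matrix.of_apply, Real.sign_of_neg (sub_neg.2 hj'),
      Real.sign_of_neg (sub_neg.2 hj''), one_mul]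

lemma prod_abs_sub_eq_abs_det_vandermonde (x : Fin N → ℝ) :
    ∏ j, ∏ k ∈ Finset.Ioi j, |x k - x j| = |(Matrix.vandermonde x).det| := by
  simp only [Matrix.det_vandermonde, Finset.abs_prod]

lemma prod_abs_sub_eq_det_mul_completedPfaffian (x : Fin N → ℝ) :
    ((∏ j, ∏ k ∈ Finset.Ioi j, |x k - x j| : ℝ) : ℂ) =
      ((Matrix.vandermonde x).det : ℂ) * completedPfaffian (signMatrix x) 1 := by
  by_cases hx : Function.Injective x
  · set σ := Tuple.sort x
    have hmono : StrictMono (x ∘ σ) :=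
      (Tuple.monotone_sort x).strictMono_of_injective (hx.comp σ.injective)
    have hdet : (Matrix.vandermonde (x ∘ σ)).det =
        ((Equiv.Perm.sign σ : ℤ) : ℝ) * (Matrix.vandermonde x).det :=
      Matrix.det_permute σ (Matrix.vandermonde x)
    have habs : ∏ j, ∏ k ∈ Finset.Ioi j, |x k - x j| = (Matrix.vandermonde (x ∘ σ)).det := by
      have hnonneg : 0 ≤ (Matrix.vandermonde (x ∘ σ)).det := by
        rw [Matrix.det_vandermonde]
        exact Finset.prod_nonneg fun j _ => Finset.prod_nonneg fun k hk =>
          (sub_pos.2 (hmono (Finset.mem_Ioi.1 hk))).le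
      rw [prod_abs_sub_eq_abs_det_vandermonde, ← abs_of_nonneg hnonneg, hdet, abs_mul]
      rcases Int.units_eq_one_or (Equiv.Perm.sign σ) with h | h <;> simp [h]
    have hpf : 1 = ((Equiv.Perm.sign σ : ℤ) : ℂ) * completedPfaffian (signMatrix x) 1 := by
      rw [← completedPfaffian_comp_perm _ (signMatrix_skew x),
        ← completedPfaffian_signMatrix_of_strictMono hmono]
      rfl
    rw [habs, hdet]
    push_cast
    linear_combination ((Equiv.Perm.sign σ : ℤ) : ℂ) * ((Matrix.vandermonde x).det : ℂ) * hpf +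
      ((Matrix.vandermonde x).det : ℂ) * completedPfaffian (signMatrix x) 1 *
        sign_mul_sign_self (R := ℂ) σ
  · have hdet : (Matrix.vandermonde x).det = 0 :=
      not_not.1 fun h => hx (Matrix.det_vandermonde_ne_zero_iff.1 h)
    rw [prod_abs_sub_eq_abs_det_vandermonde, hdet, abs_zero, Complex.ofReal_zero, zero_mul]

end Vandermonde

/-! ## Ensembles as Pfaffians of moments -/

section Moments

/-- The skew inner product `∫∫ f(x) g(y) sgn(y - x)`. -/
def sgnForm (f g : ℝ → ℂ) : ℂ :=
  ∫ p : ℝ × ℝ, f p.1 * g p.2 * ((Real.sign (p.2 - p.1) : ℝ) : ℂ)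

lemma measurable_realSign : Measurable Real.sign :=
  Measurable.ite measurableSet_Iio measurable_const
    (Measurable.ite measurableSet_Ioi measurable_const measurable_const)

lemma abs_realSign_le_one (x : ℝ) : |Real.sign x| ≤ 1 := by
  rcases Real.sign_apply_eq x with h | h | h <;> simp [h]

lemma integrable_mul_sign {f g : ℝ → ℂ} (hf : Integrable f) (hg : Integrable g) :
    Integrable fun p : ℝ × ℝ => f p.1 * g p.2 * ((Real.sign (p.2 - p.1) : ℝ) : ℂ) :=
  (hf.mul_prod hg).mul_bdd (c := 1)
    (Complex.measurable_ofReal.comp (measurable_realSign.comp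
      (measurable_snd.sub measurable_fst))).aestronglyMeasurable
    (Filter.Eventually.of_forall fun p => by simpa using abs_realSign_le_one _)

lemma sgnForm_skew (f g : ℝ → ℂ) : sgnForm f g = -sgnForm g f := by
  rw [sgnForm, sgnForm, ← integral_neg, Measure.volume_eq_prod, ← integral_prod_swap]
  refine integral_congr_ae (Filter.Eventually.of_forall fun p => ?_)
  simp only [Prod.fst_swap, Prod.snd_swap, ← neg_sub p.2 p.1, Real.sign_neg, Complex.ofReal_neg]
  ring

variable {N : ℕ} (v : ℝ → ℂ) (p : Fin N → Polynomial ℝ)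

/-- The skew inner products of the functions `v(x) p_j(x)`. -/
def momentMatrix : Matrix (Fin N) (Fin N) ℂ :=
  Matrix.of fun j k => sgnForm (fun x => v x * (p j).eval x) fun x => v x * (p k).eval x

/-- The integrals of the functions `v(x) p_j(x)`. -/
def momentVec (j : Fin N) : ℂ := ∫ x, v x * (p j).eval x

lemma momentMatrix_skew (j k : Fin N) : momentMatrix v p j k = -momentMatrix v p k j :=
  sgnForm_skew (fun x => v x * (p j).eval x) fun x => v x * (p k).eval x

variable {v p}

theorem integral_prod_mul_prod_abs_sub (hmonic : ∀ j, (p j).Monic)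
    (hdeg : ∀ j, (p j).natDegree = j) (hint : ∀ j, Integrable fun x => v x * (p j).eval x) :
    ∫ x : Fin N → ℝ, (∏ l, v (x l)) * ((∏ j, ∏ k ∈ Finset.Ioi j, |x k - x j| : ℝ) : ℂ) =
      N.factorial * completedPfaffian (momentMatrix v p) (momentVec v p) := by
  obtain ⟨r, m, hr, h⟩ := exists_layout N
  have hdet (x : Fin N → ℝ) : (Matrix.of fun j l => v (x l) * (p j).eval (x l)).det =
      (∏ l, v (x l)) * ((Matrix.vandermonde x).det : ℂ) := by
    rw [Matrix.det_mul_row (fun l => v (x l)) fun j l => (((p j).eval (x l) : ℝ) : ℂ),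
      Matrix.det_eval_matrixOfPolynomials_eq_det_vandermonde x p hdeg hmonic,
      ← Matrix.det_transpose]
    exact congrArg _ (RingHom.map_det Complex.ofRealHom _).symm
  have hpt (x : Fin N → ℝ) :
      (∏ l, v (x l)) * ((∏ j, ∏ k ∈ Finset.Ioi j, |x k - x j| : ℝ) : ℂ) =
        1 / (2 ^ m * m.factorial) * ((Matrix.of fun j l => v (x l) * (p j).eval (x l)).det *
          pfSum (layout h) (signMatrix x) 1) := by
    rw [prod_abs_sub_eq_det_mul_completedPfaffian, hdet,
      completedPfaffian_eq _ (signMatrix_skew x) hr h]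
    ring
  simp only [hpt]
  rw [integral_const_mul, completedPfaffian_eq _ (momentMatrix_skew v p) hr h, mul_left_comm]
  have hε (j k : Fin N) : Integrable fun q : ℝ × ℝ => v q.1 * (p j).eval q.1 *
      (v q.2 * (p k).eval q.2) * ((Real.sign (q.2 - q.1) : ℝ) : ℂ) := by
    simpa only using integrable_mul_sign (hint j) (hint k)
  have hη (j : Fin N) : Integrable fun x => v x * (p j).eval x * 1 := by
    simpa only [mul_one] using hint j
  have hdB := integral_det_mul_pfSum (layout h) (φ := fun (j : Fin N) x => v x * (p j).eval x)
    (ε := fun q => ((Real.sign (q.2 - q.1) : ℝ) : ℂ)) (η := fun _ => 1) hε hη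
  simp only [Fintype.card_fin, mul_one] at hdB
  exact congrArg _ hdB

end Moments

section GenFun

variable {w : ℝ → ℝ} {N : ℕ}

lemma weightProd_nonneg (hw : ∀ x, 0 ≤ w x) (x : Fin N → ℝ) : 0 ≤ weightProd w N x :=
  mul_nonneg (Finset.prod_nonneg fun _ _ => hw _)
    (Finset.prod_nonneg fun _ _ => Finset.prod_nonneg fun _ _ => abs_nonneg _)

lemma integrable_weightProd (hZ : partitionFn w N ≠ 0) : Integrable (weightProd w N) :=
  not_not.1 fun h => hZ (integral_undef h)

lemma isFiniteMeasure_ensemble (hZ : partitionFn w N ≠ 0) : IsFiniteMeasure (ensemble w N) :=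
  isFiniteMeasure_withDensity_ofReal ((integrable_weightProd hZ).const_mul _).hasFiniteIntegral

lemma integral_ensemble (hw : ∀ x, 0 ≤ w x) (hZ : partitionFn w N ≠ 0) (f : (Fin N → ℝ) → ℂ) :
    ∫ x, f x ∂ensemble w N = 1 / partitionFn w N * ∫ x, weightProd w N x * f x := by
  have hZ0 : 0 ≤ 1 / partitionFn w N :=
    one_div_nonneg.2 (integral_nonneg fun x => weightProd_nonneg hw x)
  rw [ensemble, integral_withDensity_eq_integral_toReal_smul₀
    ((integrable_weightProd hZ).const_mul _).aestronglyMeasurable.aemeasurable.ennreal_ofReal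
    (Filter.Eventually.of_forall fun _ => ENNReal.ofReal_lt_top), ← integral_const_mul]
  refine integral_congr_ae (Filter.Eventually.of_forall fun x => ?_)
  simp only [ENNReal.toReal_ofReal (mul_nonneg hZ0 (weightProd_nonneg hw x)), Complex.real_smul]
  push_cast
  ring

lemma ncard_setOf_lt_eq_sum (s : ℝ) (x : Fin N → ℝ) :
    Set.ncard {l : Fin N | s < x l} = ∑ l, if s < x l then 1 else 0 := by
  rw [Finset.sum_boole, Set.ncard_eq_toFinset_card', Set.toFinset_ofPred]
  rfl

lemma measurableSet_ncard_eq (s : ℝ) (k : ℕ) :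
    MeasurableSet {x : Fin N → ℝ | Set.ncard {l : Fin N | s < x l} = k} := by
  simp only [ncard_setOf_lt_eq_sum]
  exact measurableSet_eq_fun (Finset.measurable_sum _ fun l _ => Measurable.ite
    (measurableSet_lt measurable_const (measurable_pi_apply l)) measurable_const measurable_const)
    measurable_const

/-- The factor attached by the generating function to an eigenvalue at `x`. -/
def markFactor (s : ℝ) (ζ : ℂ) (x : ℝ) : ℂ := if s < x then ζ else 1

lemma sum_pow_mul_indicator_ncard (s : ℝ) (ζ : ℂ) (x : Fin N → ℝ) :
    ∑ k ∈ Finset.range (N + 1),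
      ζ ^ k * {x : Fin N → ℝ | Set.ncard {l : Fin N | s < x l} = k}.indicator (fun _ => 1) x =
      ∏ l, markFactor s ζ (x l) := by
  have hle : Set.ncard {l : Fin N | s < x l} ∈ Finset.range (N + 1) :=
    Finset.mem_range_succ_iff.2 ((Set.ncard_le_card _).trans_eq (by simp))
  rw [Finset.sum_eq_single_of_mem _ hle fun k _ hk => by
    rw [indicator_of_notMem (fun h => hk h.symm), mul_zero]]
  rw [indicator_of_mem (by simp), mul_one, ncard_setOf_lt_eq_sum, ← Finset.prod_pow_eq_pow_sum]
  refine Finset.prod_congr rfl fun l _ => ?_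
  unfold markFactor
  split_ifs <;> simp

lemma genFun_eq_integral_ensemble (hZ : partitionFn w N ≠ 0) (s : ℝ) (ζ : ℂ) :
    genFun w N s ζ = ∫ x, ∏ l, markFactor s ζ (x l) ∂ensemble w N := by
  have := isFiniteMeasure_ensemble hZ
  simp only [← sum_pow_mul_indicator_ncard]
  rw [genFun, integral_finsetSum _ fun k _ => ((integrable_const (1 : ℂ)).indicator
    (measurableSet_ncard_eq s k)).const_mul _]
  refine Finset.sum_congr rfl fun k _ => ?_
  rw [integral_const_mul, integral_indicator_const _ (measurableSet_ncard_eq s k), gapProb,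
    Complex.real_smul, mul_one]

lemma measurable_markFactor (s : ℝ) (ζ : ℂ) : Measurable (markFactor s ζ) :=
  Measurable.ite measurableSet_Ioi measurable_const measurable_const

lemma norm_markFactor_le (s : ℝ) (ζ : ℂ) (x : ℝ) : ‖markFactor s ζ x‖ ≤ max ‖ζ‖ 1 := by
  unfold markFactor
  split_ifs <;> simp

lemma integrable_mul_markFactor {f : ℝ → ℂ} (hf : Integrable f) (s : ℝ) (ζ : ℂ) :
    Integrable fun x => f x * markFactor s ζ x :=
  hf.mul_bdd (measurable_markFactor s ζ).aestronglyMeasurable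
    (Filter.Eventually.of_forall (norm_markFactor_le s ζ))

variable {p : Fin N → Polynomial ℝ}

theorem partitionFn_eq_completedPfaffian (hmonic : ∀ j, (p j).Monic)
    (hdeg : ∀ j, (p j).natDegree = j) (hint : ∀ j, Integrable fun x => w x * (p j).eval x) :
    (partitionFn w N : ℂ) = N.factorial *
      completedPfaffian (momentMatrix (fun x => w x) p) (momentVec (fun x => w x) p) := by
  rw [← integral_prod_mul_prod_abs_sub hmonic hdeg fun j => by simpa using (hint j).ofReal (𝕜 := ℂ),
    partitionFn, ← integral_complex_ofReal]
  exact integral_congr_ae (Filter.Eventually.of_forall fun x => by simp [weightProd])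

theorem genFun_eq_completedPfaffian (hw : ∀ x, 0 ≤ w x) (hZ : partitionFn w N ≠ 0)
    (hmonic : ∀ j, (p j).Monic) (hdeg : ∀ j, (p j).natDegree = j)
    (hint : ∀ j, Integrable fun x => w x * (p j).eval x) (s : ℝ) (ζ : ℂ) :
    genFun w N s ζ = N.factorial / partitionFn w N *
      completedPfaffian (momentMatrix (fun x => w x * markFactor s ζ x) p)
        (momentVec (fun x => w x * markFactor s ζ x) p) := by
  have hmark (j : Fin N) : Integrable fun x => w x * markFactor s ζ x * (p j).eval x := by
    simpa [mul_right_comm] using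
      integrable_mul_markFactor ((hint j).ofReal (𝕜 := ℂ)) s ζ
  rw [genFun_eq_integral_ensemble hZ, integral_ensemble hw hZ, div_eq_inv_mul (N.factorial : ℂ),
    mul_assoc, ← integral_prod_mul_prod_abs_sub hmonic hdeg hmark, one_div]
  refine congrArg _ (integral_congr_ae (Filter.Eventually.of_forall fun x => ?_))
  simp only [weightProd, Finset.prod_mul_distrib]
  push_cast
  ring

end GenFun

/-! ## Weights with a Pearson equation -/

open Polynomial

section Raising

variable {σ τ : ℝ[X]}

/-- The operator `p ↦ τ p - σ p'`, which is `p ↦ -(σ w p)' / w` for a weight `w` satisfying the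
Pearson equation `(σ w)' = -τ w`. -/
def raising (σ τ p : ℝ[X]) : ℝ[X] := τ * p - σ * derivative p

lemma natDegree_mul_derivative_lt (hσ : σ.natDegree ≤ 1) (hτ : τ.natDegree = 1)
    (hτm : τ.Monic) {p : ℝ[X]} (hp : p.Monic) :
    (σ * derivative p).natDegree < (τ * p).natDegree := by
  rw [hτm.natDegree_mul hp, hτ]
  by_cases h0 : p.natDegree = 0
  · simp [derivative_of_natDegree_zero h0]
  · have hder := natDegree_derivative_lt h0
    have hmul := natDegree_mul_le (p := σ) (q := derivative p)
    omega

lemma monic_raising (hσ : σ.natDegree ≤ 1) (hτ : τ.natDegree = 1) (hτm : τ.Monic) {p : ℝ[X]}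
    (hp : p.Monic) : (raising σ τ p).Monic :=
  (hτm.mul hp).sub_of_left (degree_lt_degree (natDegree_mul_derivative_lt hσ hτ hτm hp))

lemma natDegree_raising (hσ : σ.natDegree ≤ 1) (hτ : τ.natDegree = 1) (hτm : τ.Monic) {p : ℝ[X]}
    (hp : p.Monic) : (raising σ τ p).natDegree = p.natDegree + 1 := by
  rw [raising, natDegree_sub_eq_left_of_natDegree_lt (natDegree_mul_derivative_lt hσ hτ hτm hp),
    hτm.natDegree_mul hp, hτ, add_comm]

lemma raising_mul (p q : ℝ[X]) :
    raising σ τ (p * q) = raising σ τ p * q - σ * (p * derivative q) := by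
  simp only [raising, derivative_mul]
  ring

end Raising

/-- A weight with finite moments that satisfies the Pearson equation `(σ w)' = -τ w`, in the
integrated form `∫_x^∞ (τ p - σ p') w = σ(x) w(x) p(x)`, which includes the vanishing of `σ w p` at
the ends of the support of `w`. -/
structure IsPearson (w : ℝ → ℝ) (σ τ : ℝ[X]) : Prop where
  natDegree_sigma_le : σ.natDegree ≤ 1
  natDegree_tau : τ.natDegree = 1
  monic_tau : τ.Monic
  integrable : ∀ p : ℝ[X], Integrable fun x => w x * p.eval x
  integral_Ioi : ∀ (p : ℝ[X]) (x : ℝ),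
    ∫ y in Ioi x, w y * (raising σ τ p).eval y = w x * (σ * p).eval x

lemma integral_mul_sign {g : ℝ → ℝ} (hg : Integrable g) (x : ℝ) :
    ∫ y, g y * Real.sign (y - x) = 2 * (∫ y in Ioi x, g y) - ∫ y, g y := by
  rw [← integral_indicator measurableSet_Ioi, ← integral_const_mul,
    ← integral_sub ((hg.indicator measurableSet_Ioi).const_mul _) hg]
  have hne : ∀ᵐ y : ℝ, y ≠ x := by simp [ae_iff]
  refine integral_congr_ae ?_
  filter_upwards [hne] with y hy
  rcases lt_or_gt_of_ne hy with h | h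
  · rw [Real.sign_of_neg (sub_neg.2 h), indicator_of_notMem (by simpa using h.le)]
    ring
  · rw [Real.sign_of_pos (sub_pos.2 h), indicator_of_mem (by simpa using h)]
    ring

lemma sgnForm_ofReal {f g : ℝ → ℝ} (hf : Integrable f) (hg : Integrable g) :
    sgnForm (fun x => f x) (fun x => g x) =
      ((∫ x, f x * (2 * (∫ y in Ioi x, g y) - ∫ y, g y) : ℝ) : ℂ) := by
  have hf' : Integrable fun x => (f x : ℂ) := hf.ofReal
  have hg' : Integrable fun x => (g x : ℂ) := hg.ofReal
  have hsign : Integrable fun p : ℝ × ℝ => (f p.1 : ℂ) * g p.2 * Real.sign (p.2 - p.1) := by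
    simpa only using integrable_mul_sign hf' hg'
  rw [sgnForm, Measure.volume_eq_prod, integral_prod _ hsign, ← integral_complex_ofReal]
  refine integral_congr_ae (Filter.Eventually.of_forall fun x => ?_)
  simp only [← integral_mul_sign hg]
  simp only [Complex.ofReal_mul, ← integral_complex_ofReal, mul_assoc, integral_const_mul]

namespace IsPearson

variable {w : ℝ → ℝ} {σ τ : ℝ[X]} (h : IsPearson w σ τ)

include h

lemma integral_raising (p : ℝ[X]) : ∫ x, w x * (raising σ τ p).eval x = 0 := by
  have hlim : Filter.Tendsto (fun x => w x * (σ * p).eval x) Filter.atBot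
      (nhds (∫ x, w x * (raising σ τ p).eval x)) := by
    simp only [← h.integral_Ioi]
    exact (aecover_Ioi Filter.tendsto_id).integral_tendsto_of_countably_generated (h.integrable _)
  exact (h.integrable (σ * p)).integrableAtFilter _ |>.eq_zero_of_tendsto (fun s hs => by
    obtain ⟨a, ha⟩ := Filter.mem_atBot_sets.1 hs
    exact measure_mono_top (fun x hx => ha x hx) Real.volume_Iic) hlim

lemma integral_raising_mul (p q : ℝ[X]) :
    ∫ x, w x * (raising σ τ p * q).eval x = ∫ x, w x * (σ * (p * derivative q)).eval x := by
  rw [← sub_eq_zero, ← integral_sub (h.integrable _) (h.integrable _),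
    ← h.integral_raising (p * q), raising_mul]
  simp only [eval_sub, mul_sub]

lemma sgnForm_raising (p q : ℝ[X]) :
    sgnForm (fun x => w x * p.eval x) (fun x => w x * (raising σ τ q).eval x) =
      ((2 * ∫ x, w x ^ 2 * (σ * (p * q)).eval x : ℝ) : ℂ) := by
  have hform := sgnForm_ofReal (h.integrable p) (h.integrable (raising σ τ q))
  simp only [Complex.ofReal_mul (w _)] at hform
  rw [hform, h.integral_raising, ← integral_const_mul]
  simp only [h.integral_Ioi, eval_mul]
  exact congrArg _ (integral_congr_ae (Filter.Eventually.of_forall fun x => by ring))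

end IsPearson

/-- The polynomials `D_k D_{k+1} ⋯ D_{k+n-1} 1` with `D_i = raising (σ i) (τ i)`, which a weight
satisfying a chain of Pearson equations expresses by a Rodrigues formula. -/
def rodrigues (σ τ : ℕ → ℝ[X]) : ℕ → ℕ → ℝ[X]
  | _, 0 => 1
  | k, n + 1 => raising (σ k) (τ k) (rodrigues σ τ (k + 1) n)

/-- A sequence of weights satisfying Pearson equations `(σ k ω k)' = -τ k ω k`, in which each weight
is the preceding one times its `σ`; the classical weights start such sequences. -/
structure IsPearsonChain (ω : ℕ → ℝ → ℝ) (σ τ : ℕ → ℝ[X]) : Prop where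
  isPearson : ∀ k, IsPearson (ω k) (σ k) (τ k)
  succ : ∀ k x, ω (k + 1) x = (σ k).eval x * ω k x

namespace IsPearsonChain

variable {ω : ℕ → ℝ → ℝ} {σ τ : ℕ → ℝ[X]} (h : IsPearsonChain ω σ τ)

include h

lemma monic_rodrigues (k n : ℕ) :
    (rodrigues σ τ k n).Monic ∧ (rodrigues σ τ k n).natDegree = n := by
  induction n generalizing k with
  | zero => exact ⟨monic_one, natDegree_one⟩
  | succ n ih =>
    obtain ⟨hσ, hτ, hτm, -, -⟩ := h.isPearson k
    obtain ⟨hmonic, hdeg⟩ := ih (k + 1)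
    exact ⟨monic_raising hσ hτ hτm hmonic, by
      rw [rodrigues, natDegree_raising hσ hτ hτm hmonic, hdeg]⟩

lemma integral_rodrigues_mul (k n : ℕ) (q : ℝ[X]) :
    ∫ x, ω k x * (rodrigues σ τ k n * q).eval x =
      ∫ x, ω (k + n) x * (derivative^[n] q).eval x := by
  induction n generalizing k q with
  | zero => simp [rodrigues]
  | succ n ih =>
    calc ∫ x, ω k x * (rodrigues σ τ k (n + 1) * q).eval x
        = ∫ x, ω k x * (σ k * (rodrigues σ τ (k + 1) n * derivative q)).eval x :=
          (h.isPearson k).integral_raising_mul _ q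
      _ = ∫ x, ω (k + 1) x * (rodrigues σ τ (k + 1) n * derivative q).eval x := by
          simp only [h.succ, eval_mul, mul_assoc, mul_left_comm]
      _ = ∫ x, ω (k + (n + 1)) x * (derivative^[n + 1] q).eval x := by
          rw [ih, Function.iterate_succ_apply, add_right_comm, add_assoc]

lemma integral_rodrigues_mul_of_natDegree_lt (k : ℕ) {n : ℕ} {q : ℝ[X]} (hq : q.natDegree < n) :
    ∫ x, ω k x * (rodrigues σ τ k n * q).eval x = 0 := by
  rw [h.integral_rodrigues_mul, iterate_derivative_eq_zero hq]
  simp only [eval_zero, mul_zero, integral_zero]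

lemma integral_rodrigues_mul_of_monic (k : ℕ) {q : ℝ[X]} (hq : q.Monic) :
    ∫ x, ω k x * (rodrigues σ τ k q.natDegree * q).eval x =
      (q.natDegree.factorial : ℝ) * ∫ x, ω (k + q.natDegree) x := by
  have hconst : derivative^[q.natDegree] q = C (q.natDegree.factorial : ℝ) := by
    rw [eq_C_of_natDegree_le_zero (p := derivative^[q.natDegree] q)
      ((natDegree_iterate_derivative q _).trans (Nat.sub_self _).le), coeff_iterate_derivative,
      zero_add, Nat.descFactorial_self, hq.coeff_natDegree, nsmul_one]
  rw [h.integral_rodrigues_mul, hconst, ← integral_const_mul]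
  simp only [eval_C, mul_comm]

end IsPearsonChain

/-- The basis `1, D h_0, D h_1, …` with `D = raising σ τ`. For a weight `w` with
`(σ w)' = -τ w` and `h` orthogonal with respect to `σ w²`, the skew form `sgnForm` is tridiagonal
in this basis. -/
def skewBasis (σ τ : ℝ[X]) (h : ℕ → ℝ[X]) : ℕ → ℝ[X]
  | 0 => 1
  | n + 1 => raising σ τ (h n)

section SkewBasis

variable {w : ℝ → ℝ} {σ τ : ℝ[X]} {ω : ℕ → ℝ → ℝ} {σ' τ' : ℕ → ℝ[X]}

lemma monic_skewBasis (hw : IsPearson w σ τ) (hω : IsPearsonChain ω σ' τ') (n : ℕ) :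
    (skewBasis σ τ (rodrigues σ' τ' 0) n).Monic ∧
      (skewBasis σ τ (rodrigues σ' τ' 0) n).natDegree = n := by
  obtain ⟨hσ, hτ, hτm, -, -⟩ := hw
  cases n with
  | zero => exact ⟨monic_one, natDegree_one⟩
  | succ n =>
    obtain ⟨hmonic, hdeg⟩ := hω.monic_rodrigues 0 n
    exact ⟨monic_raising hσ hτ hτm hmonic, by
      rw [skewBasis, natDegree_raising hσ hτ hτm hmonic, hdeg]⟩

lemma sgnForm_skewBasis_succ (hw : IsPearson w σ τ) (hω0 : ∀ x, ω 0 x = σ.eval x * w x ^ 2)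
    (p : ℝ[X]) (n : ℕ) :
    sgnForm (fun x => w x * p.eval x)
        (fun x => w x * (skewBasis σ τ (rodrigues σ' τ' 0) (n + 1)).eval x) =
      ((2 * ∫ x, ω 0 x * (rodrigues σ' τ' 0 n * p).eval x : ℝ) : ℂ) := by
  rw [skewBasis, hw.sgnForm_raising]
  simp only [hω0, eval_mul]
  congr 3 with x
  ring

lemma sgnForm_skewBasis_of_lt (hw : IsPearson w σ τ) (hω : IsPearsonChain ω σ' τ')
    (hω0 : ∀ x, ω 0 x = σ.eval x * w x ^ 2) {j n : ℕ} (hj : j < n) :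
    sgnForm (fun x => w x * (skewBasis σ τ (rodrigues σ' τ' 0) (n + 1)).eval x)
      (fun x => w x * (skewBasis σ τ (rodrigues σ' τ' 0) j).eval x) = 0 := by
  rw [sgnForm_skew, sgnForm_skewBasis_succ hw hω0, hω.integral_rodrigues_mul_of_natDegree_lt 0
    ((monic_skewBasis hw hω j).2.trans_lt hj), mul_zero, Complex.ofReal_zero, neg_zero]

lemma sgnForm_skewBasis_self_succ (hw : IsPearson w σ τ) (hω : IsPearsonChain ω σ' τ')
    (hω0 : ∀ x, ω 0 x = σ.eval x * w x ^ 2) (n : ℕ) :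
    sgnForm (fun x => w x * (skewBasis σ τ (rodrigues σ' τ' 0) n).eval x)
        (fun x => w x * (skewBasis σ τ (rodrigues σ' τ' 0) (n + 1)).eval x) =
      ((2 * (n.factorial * ∫ x, ω n x) : ℝ) : ℂ) := by
  obtain ⟨hmonic, hdeg⟩ := monic_skewBasis hw hω n
  have hnorm := hω.integral_rodrigues_mul_of_monic 0 hmonic
  rw [hdeg, zero_add] at hnorm
  rw [sgnForm_skewBasis_succ hw hω0, hnorm]

lemma integral_skewBasis_succ (hw : IsPearson w σ τ) (h : ℕ → ℝ[X]) (n : ℕ) :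
    ∫ x, (w x : ℂ) * (skewBasis σ τ h (n + 1)).eval x = 0 := by
  simp only [skewBasis, ← Complex.ofReal_mul, integral_complex_ofReal, hw.integral_raising,
    Complex.ofReal_zero]

/-- The skew form of the weight `w` is tridiagonal in the skew basis, so the Pfaffian that
represents the normalisation constant is a product. -/
theorem partitionFn_eq_prod (hw : IsPearson w σ τ) (hω : IsPearsonChain ω σ' τ')
    (hω0 : ∀ x, ω 0 x = σ.eval x * w x ^ 2) {g : ℕ → ℝ} (hg0 : ∫ x, w x = g 0)
    (hg : ∀ n, 2 * (n.factorial * ∫ x, ω n x) = g n * g (n + 1)) (N : ℕ) :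
    partitionFn w N = N.factorial * ∏ j ∈ Finset.range N, g j := by
  set R := skewBasis σ τ (rodrigues σ' τ' 0) with hR
  have hRm := monic_skewBasis hw hω
  have hν0 : (∫ x, (w x : ℂ) * (R 0).eval x) = g 0 := by
    simp only [hR, skewBasis, eval_one, Complex.ofReal_one, mul_one, integral_complex_ofReal, hg0]
  have hchain := completedPfaffian_of_chain (N := N) (c := fun _ => 0) (g := fun n => (g n : ℂ))
    (A := fun j k => sgnForm (fun x => w x * (R j).eval x) (fun x => w x * (R k).eval x))
    (ν := fun n => ∫ x, (w x : ℂ) * (R n).eval x) (fun j k => sgnForm_skew _ _)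
    (fun n j hj => by rw [sgnForm_skewBasis_of_lt hw hω hω0 hj, zero_mul])
    (fun n => by rw [integral_skewBasis_succ hw, zero_mul])
    (fun n => by rw [sgnForm_skewBasis_self_succ hw hω hω0, hg, Complex.ofReal_mul]) hν0
  have hpf := partitionFn_eq_completedPfaffian (w := w) (p := fun j : Fin N => R j)
    (fun j => (hRm j).1) (fun j => (hRm j).2) (fun j => hw.integrable _)
  exact_mod_cast hpf.trans (congrArg _ hchain)

theorem genFun_eq_completedPfaffian_of_pearson (hw : IsPearson w σ τ) (hω : IsPearsonChain ω σ' τ')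
    (hω0 : ∀ x, ω 0 x = σ.eval x * w x ^ 2) {g : ℕ → ℝ} (hg0 : ∫ x, w x = g 0)
    (hg : ∀ n, 2 * (n.factorial * ∫ x, ω n x) = g n * g (n + 1)) (hg' : ∀ n, g n ≠ 0)
    (hnonneg : ∀ x, 0 ≤ w x) (N : ℕ) (s : ℝ) (ζ : ℂ) :
    genFun w N s ζ = (∏ j : Fin N, (g j : ℂ)⁻¹) *
      completedPfaffian
        (momentMatrix (fun x => w x * markFactor s ζ x) fun j : Fin N => X ^ (j : ℕ))
        (momentVec (fun x => w x * markFactor s ζ x) fun j => X ^ (j : ℕ)) := by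
  have hZ := partitionFn_eq_prod hw hω hω0 hg0 hg N
  have hfac : (N.factorial : ℝ) ≠ 0 := Nat.cast_ne_zero.2 N.factorial_ne_zero
  have hZ0 : partitionFn w N ≠ 0 :=
    hZ ▸ mul_ne_zero hfac (Finset.prod_ne_zero_iff.2 fun j _ => hg' j)
  rw [genFun_eq_completedPfaffian hnonneg hZ0 (fun j => monic_X_pow _) (fun j => natDegree_X_pow _)
    (fun j => hw.integrable _), hZ, Finset.prod_range, Finset.prod_inv_distrib, Complex.ofReal_mul,
    Complex.ofReal_natCast, Complex.ofReal_prod, div_mul_cancel_left₀ (mod_cast hfac)]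

end SkewBasis

section Pearson

variable {w : ℝ → ℝ} {σ τ : ℝ[X]}

lemma integrable_mul_eval (h : ∀ n : ℕ, Integrable fun x => w x * x ^ n) (p : ℝ[X]) :
    Integrable fun x => w x * p.eval x := by
  simp only [eval_eq_sum_range, Finset.mul_sum]
  exact integrable_finsetSum _ fun n _ => by
    simpa only [mul_left_comm] using (h n).const_mul (p.coeff n)

lemma integral_Ioi_raising (hint : ∀ p : ℝ[X], Integrable fun x => w x * p.eval x) {a : ℝ}
    (hcont : ContinuousWithinAt (fun x => w x * σ.eval x) (Ici a) a)
    (hder : ∀ x ∈ Ioi a, HasDerivAt (fun x => w x * σ.eval x) (-(w x * τ.eval x)) x) (p : ℝ[X]) :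
    ∫ x in Ioi a, w x * (raising σ τ p).eval x = w a * (σ * p).eval a := by
  have hder' : ∀ x ∈ Ioi a, HasDerivAt (fun x => -(w x * σ.eval x * p.eval x))
      (w x * (raising σ τ p).eval x) x := fun x hx => by
    refine ((hder x hx).mul (p.hasDerivAt x)).neg.congr_deriv ?_
    simp only [raising, eval_sub, eval_mul]
    ring
  have hint' : Integrable fun x => -(w x * σ.eval x * p.eval x) := by
    simpa only [eval_mul, mul_assoc, Pi.neg_def] using (hint (σ * p)).neg
  have hlim := tendsto_zero_of_hasDerivAt_of_integrableOn_Ioi hder'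
    (hint (raising σ τ p)).integrableOn hint'.integrableOn
  rw [integral_Ioi_of_hasDerivAt_of_tendsto (hcont.mul p.continuous.continuousWithinAt).neg hder'
    (hint _).integrableOn hlim, eval_mul, Pi.neg_apply, Pi.mul_apply, zero_sub, neg_neg, mul_assoc]

lemma IsPearson.const_mul (h : IsPearson w σ τ) (r : ℝ) : IsPearson (fun x => r * w x) σ τ where
  natDegree_sigma_le := h.natDegree_sigma_le
  natDegree_tau := h.natDegree_tau
  monic_tau := h.monic_tau
  integrable p := by simpa only [mul_assoc] using (h.integrable p).const_mul r
  integral_Ioi p x := by simp only [mul_assoc, integral_const_mul, h.integral_Ioi]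

end Pearson

/-! ## The Gaussian weight -/

/-- The weight `e^{-c x²}`. -/
def gaussWeight (c x : ℝ) : ℝ := Real.exp (-(c * x ^ 2))

lemma weightG_eq_gaussWeight : weightG = gaussWeight (1 / 2) := by
  ext x
  rw [weightG, gaussWeight]
  ring_nf

lemma integral_gaussWeight (c : ℝ) : ∫ x, gaussWeight c x = √(Real.pi / c) := by
  simpa only [gaussWeight, neg_mul] using integral_gaussian c

lemma hasDerivAt_gaussWeight (c x : ℝ) :
    HasDerivAt (gaussWeight c) (-(gaussWeight c x * (2 * c * x))) x := by
  refine (((hasDerivAt_pow 2 x).const_mul c).neg).exp.congr_deriv ?_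
  rw [gaussWeight, Pi.neg_apply]
  ring

lemma isPearson_gaussWeight {c : ℝ} (hc : 0 < c) :
    IsPearson (gaussWeight c) (C (1 / (2 * c))) X := by
  have hint : ∀ p : ℝ[X], Integrable fun x => gaussWeight c x * p.eval x :=
    integrable_mul_eval fun n => by
      simpa only [gaussWeight, Real.rpow_natCast, neg_mul, mul_comm] using
        integrable_rpow_mul_exp_neg_mul_sq hc (s := n) (by linarith [n.cast_nonneg (α := ℝ)])
  have hder : ∀ x, HasDerivAt (fun x => gaussWeight c x * (C (1 / (2 * c))).eval x)
      (-(gaussWeight c x * (X : ℝ[X]).eval x)) x := fun x => by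
    simp only [eval_C, eval_X]
    refine ((hasDerivAt_gaussWeight c x).mul_const _).congr_deriv ?_
    field_simp
  exact ⟨(natDegree_C _).trans_le zero_le_one, natDegree_X, monic_X, hint, fun p x =>
    integral_Ioi_raising hint (hder x).continuousAt.continuousWithinAt (fun y _ => hder y) p⟩

lemma isPearsonChain_gaussWeight :
    IsPearsonChain (fun k x => (1 / 2) ^ k * gaussWeight 1 x) (fun _ => C (1 / 2)) fun _ => X where
  isPearson k := by simpa using (isPearson_gaussWeight one_pos).const_mul ((1 / 2) ^ k)
  succ k x := by
    rw [eval_C]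
    ring

/-- The factor `g_j` in the normalisation constant `N! ∏_{j < N} g_j` of the Gaussian ensemble. -/
def gaussNorm (j : ℕ) : ℝ := √2 * Real.Gamma ((j + 1) / 2)

lemma gaussNorm_pos (j : ℕ) : 0 < gaussNorm j :=
  mul_pos (by positivity) (Real.Gamma_pos_of_pos (by positivity))

lemma integral_gaussWeight_half : ∫ x, gaussWeight (1 / 2) x = gaussNorm 0 := by
  rw [integral_gaussWeight, gaussNorm, Nat.cast_zero, zero_add, Real.Gamma_one_half_eq,
    ← Real.sqrt_mul two_pos.le]
  ring_nf

lemma Gamma_half_mul_Gamma_half_succ (n : ℕ) :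
    Real.Gamma ((n + 1) / 2) * Real.Gamma (((n + 1 : ℕ) + 1) / 2) =
      n.factorial * (1 / 2) ^ n * √Real.pi := by
  have hdup := Real.Gamma_mul_Gamma_add_half (((n : ℝ) + 1) / 2)
  rwa [show ((n : ℝ) + 1) / 2 + 1 / 2 = ((n + 1 : ℕ) + 1) / 2 by push_cast; ring,
    show 2 * (((n : ℝ) + 1) / 2) = n + 1 by ring, Real.Gamma_nat_eq_factorial,
    show (1 : ℝ) - (n + 1) = -(n : ℝ) by ring, Real.rpow_neg two_pos.le, Real.rpow_natCast,
    ← inv_pow, ← one_div] at hdup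

lemma two_mul_factorial_mul_integral_gaussWeight (n : ℕ) :
    2 * (n.factorial * ∫ x, (1 / 2) ^ n * gaussWeight 1 x) = gaussNorm n * gaussNorm (n + 1) := by
  rw [integral_const_mul, integral_gaussWeight, div_one, gaussNorm, gaussNorm, mul_mul_mul_comm,
    Gamma_half_mul_Gamma_half_succ, Real.mul_self_sqrt two_pos.le]
  ring

theorem genFun_weightG (N : ℕ) (s : ℝ) (ζ : ℂ) :
    genFun weightG N s ζ = (∏ j : Fin N, (gaussNorm j : ℂ)⁻¹) *
      completedPfaffian
        (momentMatrix (fun x => weightG x * markFactor s ζ x) fun j : Fin N => X ^ (j : ℕ))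
        (momentVec (fun x => weightG x * markFactor s ζ x) fun j => X ^ (j : ℕ)) := by
  rw [weightG_eq_gaussWeight]
  refine genFun_eq_completedPfaffian_of_pearson
    (isPearson_gaussWeight one_half_pos) isPearsonChain_gaussWeight (fun x => ?_)
    integral_gaussWeight_half two_mul_factorial_mul_integral_gaussWeight
    (fun n => (gaussNorm_pos n).ne') (fun x => (Real.exp_pos _).le) N s ζ
  rw [eval_C, gaussWeight, gaussWeight, ← Real.exp_nat_mul]
  ring_nf

/-! ## The Laguerre weight -/

/-- The weight `x^b e^{-cx}` on the half line `x > 0`, extended by zero. -/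
def laguerreWeight (b c x : ℝ) : ℝ := if 0 < x then x ^ b * Real.exp (-(c * x)) else 0

section Laguerre

variable {b c x : ℝ}

lemma weightL_eq_laguerreWeight (a : ℝ) : weightL a = laguerreWeight a (1 / 2) := by
  ext x
  rw [weightL, laguerreWeight]
  ring_nf

lemma laguerreWeight_of_pos (hx : 0 < x) :
    laguerreWeight b c x = x ^ b * Real.exp (-(c * x)) := if_pos hx

lemma laguerreWeight_of_nonpos (hx : x ≤ 0) : laguerreWeight b c x = 0 := if_neg hx.not_gt

lemma laguerreWeight_nonneg (b c x : ℝ) : 0 ≤ laguerreWeight b c x := by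
  unfold laguerreWeight
  split_ifs with h <;> positivity

lemma laguerreWeight_mul (b c b' c' x : ℝ) :
    laguerreWeight b c x * laguerreWeight b' c' x = laguerreWeight (b + b') (c + c') x := by
  rcases lt_or_ge 0 x with hx | hx
  · rw [laguerreWeight_of_pos hx, laguerreWeight_of_pos hx, laguerreWeight_of_pos hx,
      Real.rpow_add hx, mul_mul_mul_comm, ← Real.exp_add]
    ring_nf
  · simp only [laguerreWeight_of_nonpos hx, mul_zero]

lemma laguerreWeight_mul_pow (b c x : ℝ) (n : ℕ) :
    laguerreWeight b c x * x ^ n = laguerreWeight (b + n) c x := by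
  rcases lt_or_ge 0 x with hx | hx
  · rw [laguerreWeight_of_pos hx, laguerreWeight_of_pos hx, Real.rpow_add hx, Real.rpow_natCast,
      mul_right_comm]
  · simp only [laguerreWeight_of_nonpos hx, zero_mul]

lemma laguerreWeight_mul_self (b c x : ℝ) :
    laguerreWeight b c x * x = laguerreWeight (b + 1) c x := by
  simpa only [pow_one, Nat.cast_one] using laguerreWeight_mul_pow b c x 1

lemma laguerreWeight_eq_indicator (b c : ℝ) :
    laguerreWeight b c = (Ioi 0).indicator fun x => x ^ b * Real.exp (-(c * x)) := by
  ext x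
  simp [laguerreWeight, indicator_apply]

lemma integrable_laguerreWeight (hb : -1 < b) (hc : 0 < c) : Integrable (laguerreWeight b c) := by
  rw [laguerreWeight_eq_indicator, integrable_indicator_iff measurableSet_Ioi]
  simpa using integrableOn_rpow_mul_exp_neg_mul_rpow hb one_pos hc

lemma integral_laguerreWeight (hb : -1 < b) (hc : 0 < c) :
    ∫ x, laguerreWeight b c x = (1 / c) ^ (b + 1) * Real.Gamma (b + 1) := by
  rw [laguerreWeight_eq_indicator, integral_indicator measurableSet_Ioi,
    ← Real.integral_rpow_mul_exp_neg_mul_Ioi (by linarith) hc, add_sub_cancel_right]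

lemma hasDerivAt_laguerreWeight (b c : ℝ) (hx : 0 < x) :
    HasDerivAt (laguerreWeight (b + 1) c) (-(laguerreWeight b c x * (c * x - (b + 1)))) x := by
  have hpow : HasDerivAt (fun x : ℝ => x ^ (b + 1)) ((b + 1) * x ^ b) x := by
    simpa using Real.hasDerivAt_rpow_const (p := b + 1) (Or.inl hx.ne')
  have hexp : HasDerivAt (fun x : ℝ => Real.exp (-(c * x))) (Real.exp (-(c * x)) * (-c)) x := by
    simpa using (((hasDerivAt_id x).const_mul c).neg).exp
  have hprod : HasDerivAt (fun x => x ^ (b + 1) * Real.exp (-(c * x)))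
      (-(laguerreWeight b c x * (c * x - (b + 1)))) x := by
    refine (hpow.mul hexp).congr_deriv ?_
    rw [laguerreWeight_of_pos hx, Real.rpow_add hx, Real.rpow_one]
    ring
  refine hprod.congr_of_eventuallyEq ?_
  filter_upwards [lt_mem_nhds hx] with y hy using laguerreWeight_of_pos hy

lemma continuous_laguerreWeight_add_one (hb : -1 < b) : Continuous (laguerreWeight (b + 1) c) := by
  have hb' : 0 < b + 1 := by linarith
  have hmax : laguerreWeight (b + 1) c = fun x => max 0 x ^ (b + 1) * Real.exp (-(c * x)) := by
    ext x
    rcases lt_or_ge 0 x with hx | hx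
    · rw [laguerreWeight_of_pos hx, max_eq_right hx.le]
    · rw [laguerreWeight_of_nonpos hx, max_eq_left hx, Real.zero_rpow hb'.ne', zero_mul]
  rw [hmax]
  exact ((continuous_const.max continuous_id).rpow_const fun _ => Or.inr hb'.le).mul (by fun_prop)

lemma setIntegral_Ioi_laguerreWeight_mul (hx : x ≤ 0) (f : ℝ → ℝ) :
    ∫ y in Ioi x, laguerreWeight b c y * f y = ∫ y in Ioi 0, laguerreWeight b c y * f y := by
  refine setIntegral_eq_of_subset_of_forall_sdiff_eq_zero measurableSet_Ioi (Ioi_subset_Ioi hx)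
    fun y hy => ?_
  rw [laguerreWeight_of_nonpos (not_lt.1 hy.2), zero_mul]

lemma isPearson_laguerreWeight (hb : -1 < b) (hc : 0 < c) :
    IsPearson (laguerreWeight b c) (C (1 / c) * X) (X - C ((b + 1) / c)) := by
  have hint : ∀ p : ℝ[X], Integrable fun x => laguerreWeight b c x * p.eval x :=
    integrable_mul_eval fun n => by
      simpa only [laguerreWeight_mul_pow] using
        integrable_laguerreWeight (by linarith [n.cast_nonneg (α := ℝ)]) hc
  have hσ : (fun x => laguerreWeight b c x * (C (1 / c) * X : ℝ[X]).eval x) =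
      fun x => 1 / c * laguerreWeight (b + 1) c x := by
    ext x
    rw [eval_mul, eval_C, eval_X, mul_left_comm, laguerreWeight_mul_self]
  have hder : ∀ x ∈ Ioi (0 : ℝ),
      HasDerivAt (fun x => laguerreWeight b c x * (C (1 / c) * X : ℝ[X]).eval x)
        (-(laguerreWeight b c x * (X - C ((b + 1) / c) : ℝ[X]).eval x)) x := fun x hx => by
    rw [hσ, eval_sub, eval_X, eval_C]
    refine ((hasDerivAt_laguerreWeight b c hx).const_mul _).congr_deriv ?_
    field_simp
  have hcont : Continuous fun x => laguerreWeight b c x * (C (1 / c) * X : ℝ[X]).eval x := by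
    rw [hσ]
    exact (continuous_laguerreWeight_add_one hb).const_mul _
  refine ⟨(natDegree_C_mul_le _ _).trans natDegree_X_le, natDegree_X_sub_C _,
    monic_X_sub_C _, hint, fun p x => ?_⟩
  rcases le_total 0 x with hx | hx
  · exact integral_Ioi_raising hint hcont.continuousWithinAt
      (fun y hy => hder y (hx.trans_lt hy)) p
  · rw [setIntegral_Ioi_laguerreWeight_mul hx,
      integral_Ioi_raising hint hcont.continuousWithinAt hder p,
      laguerreWeight_of_nonpos hx, laguerreWeight_of_nonpos le_rfl, zero_mul, zero_mul]

lemma isPearsonChain_laguerreWeight (hb : -1 < b) :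
    IsPearsonChain (fun k x => 2 * laguerreWeight (b + k) 1 x) (fun _ => X)
      fun k => X - C (b + k + 1) where
  isPearson k := by
    simpa using (isPearson_laguerreWeight (b := b + k)
      (by linarith [k.cast_nonneg (α := ℝ)]) one_pos).const_mul 2
  succ k x := by
    rw [eval_X, Nat.cast_succ, ← add_assoc, ← laguerreWeight_mul_self]
    ring

/-- The factor `g_j` in the normalisation constant `N! ∏_{j < N} g_j` of the Laguerre ensemble. -/
def laguerreNorm (a : ℝ) (j : ℕ) : ℝ :=
  2 ^ (a + j + 1) * Real.Gamma ((j + 1) / 2) * Real.Gamma (a + (j + 2) / 2) / √Real.pi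

lemma laguerreNorm_pos {a : ℝ} (ha : -1 < a) (j : ℕ) : 0 < laguerreNorm a j := by
  have hΓ := Real.Gamma_pos_of_pos (s := ((j : ℝ) + 1) / 2) (by positivity)
  have hΓa := Real.Gamma_pos_of_pos (s := a + (j + 2) / 2) (by linarith [j.cast_nonneg (α := ℝ)])
  exact div_pos (mul_pos (mul_pos (by positivity) hΓ) hΓa) (Real.sqrt_pos.2 Real.pi_pos)

lemma integral_laguerreWeight_half {a : ℝ} (ha : -1 < a) :
    ∫ x, laguerreWeight a (1 / 2) x = laguerreNorm a 0 := by
  have hπ := (Real.sqrt_pos.2 Real.pi_pos).ne'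
  rw [integral_laguerreWeight ha one_half_pos, laguerreNorm, Nat.cast_zero, zero_add,
    Real.Gamma_one_half_eq, zero_add, div_self two_ne_zero, add_zero, one_div_one_div]
  field_simp

lemma laguerreNorm_mul_succ (a : ℝ) (n : ℕ) :
    laguerreNorm a n * laguerreNorm a (n + 1) =
      2 * (n.factorial * (2 * Real.Gamma (2 * a + 1 + n + 1))) := by
  have hdup := Real.Gamma_mul_Gamma_add_half (a + (n + 2) / 2)
  rw [show a + ((n : ℝ) + 2) / 2 + 1 / 2 = a + ((n + 1 : ℕ) + 2) / 2 by push_cast; ring,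
    show 2 * (a + ((n : ℝ) + 2) / 2) = 2 * a + 1 + n + 1 by ring] at hdup
  have hpow : (2 : ℝ) ^ (a + n + 1) * 2 ^ (a + (n + 1 : ℕ) + 1) * (1 / 2) ^ n *
      2 ^ (1 - (2 * a + 1 + n + 1)) = 2 ^ 2 := by
    rw [one_div, inv_pow, ← Real.rpow_natCast, ← Real.rpow_natCast, ← Real.rpow_neg two_pos.le,
      ← Real.rpow_add two_pos, ← Real.rpow_add two_pos, ← Real.rpow_add two_pos]
    push_cast
    ring_nf
    norm_num
  have hπ : √Real.pi ≠ 0 := (Real.sqrt_pos.2 Real.pi_pos).ne'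
  calc laguerreNorm a n * laguerreNorm a (n + 1)
      = 2 ^ (a + n + 1) * 2 ^ (a + (n + 1 : ℕ) + 1) *
          (Real.Gamma ((n + 1) / 2) * Real.Gamma (((n + 1 : ℕ) + 1) / 2)) *
          (Real.Gamma (a + (n + 2) / 2) * Real.Gamma (a + ((n + 1 : ℕ) + 2) / 2)) /
          (√Real.pi * √Real.pi) := by
        simp only [laguerreNorm]
        ring
    _ = 2 ^ (a + n + 1) * 2 ^ (a + (n + 1 : ℕ) + 1) * (1 / 2) ^ n *
          2 ^ (1 - (2 * a + 1 + n + 1)) * n.factorial * Real.Gamma (2 * a + 1 + n + 1) := by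
        rw [Gamma_half_mul_Gamma_half_succ, hdup]
        field_simp
    _ = 2 * (n.factorial * (2 * Real.Gamma (2 * a + 1 + n + 1))) := by
        rw [hpow]
        ring

lemma two_mul_factorial_mul_integral_laguerreWeight {a : ℝ} (ha : -1 < a) (n : ℕ) :
    2 * (n.factorial * ∫ x, 2 * laguerreWeight (2 * a + 1 + n) 1 x) =
      laguerreNorm a n * laguerreNorm a (n + 1) := by
  have hb : -1 < 2 * a + 1 + n := by linarith [n.cast_nonneg (α := ℝ)]
  rw [laguerreNorm_mul_succ, integral_const_mul, integral_laguerreWeight hb one_pos, div_one,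
    Real.one_rpow, one_mul]

theorem genFun_weightL {a : ℝ} (ha : -1 < a) (N : ℕ) (s : ℝ) (ζ : ℂ) :
    genFun (weightL a) N s ζ = (∏ j : Fin N, (laguerreNorm a j : ℂ)⁻¹) *
      completedPfaffian
        (momentMatrix (fun x => weightL a x * markFactor s ζ x) fun j : Fin N => X ^ (j : ℕ))
        (momentVec (fun x => weightL a x * markFactor s ζ x) fun j => X ^ (j : ℕ)) := by
  rw [weightL_eq_laguerreWeight]
  refine genFun_eq_completedPfaffian_of_pearson
    (isPearson_laguerreWeight ha one_half_pos)
    (isPearsonChain_laguerreWeight (b := 2 * a + 1) (by linarith)) (fun x => ?_)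
    (integral_laguerreWeight_half ha) (two_mul_factorial_mul_integral_laguerreWeight ha)
    (fun n => (laguerreNorm_pos ha n).ne') (laguerreWeight_nonneg a _) N s ζ
  rw [pow_two, laguerreWeight_mul, add_halves, ← two_mul, eval_mul, eval_C, eval_X,
    one_div_one_div, mul_assoc, mul_comm x, laguerreWeight_mul_self, Nat.cast_zero, add_zero]

end Laguerre

/-! ## The matrix elements -/

section Splitting

variable {f₁ f₂ g₁ g₂ : ℝ → ℂ}

lemma sgnForm_add_const_mul_left (hf₁ : Integrable f₁) (hf₂ : Integrable f₂) (hg : Integrable g₁)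
    (ζ : ℂ) :
    sgnForm (fun x => f₁ x + ζ * f₂ x) g₁ = sgnForm f₁ g₁ + ζ * sgnForm f₂ g₁ := by
  rw [sgnForm, sgnForm, sgnForm, ← integral_const_mul,
    ← integral_add (integrable_mul_sign hf₁ hg) ((integrable_mul_sign hf₂ hg).const_mul ζ)]
  refine integral_congr_ae (Filter.Eventually.of_forall fun p => ?_)
  ring

lemma sgnForm_add_const_mul (hf₁ : Integrable f₁) (hf₂ : Integrable f₂) (hg₁ : Integrable g₁)
    (hg₂ : Integrable g₂) (ζ : ℂ) :
    sgnForm (fun x => f₁ x + ζ * f₂ x) (fun x => g₁ x + ζ * g₂ x) =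
      sgnForm f₁ g₁ + ζ * (sgnForm f₁ g₂ - sgnForm g₁ f₂) + ζ ^ 2 * sgnForm f₂ g₂ := by
  have hg : Integrable fun x => g₁ x + ζ * g₂ x := hg₁.add (hg₂.const_mul ζ)
  rw [sgnForm_add_const_mul_left hf₁ hf₂ hg, sgnForm_skew f₁, sgnForm_skew f₂,
    sgnForm_add_const_mul_left hg₁ hg₂ hf₁,
    sgnForm_add_const_mul_left hg₁ hg₂ hf₂, sgnForm_skew g₁ f₁, sgnForm_skew g₂ f₁,
    sgnForm_skew g₂ f₂]
  ring

variable {f g : ℝ → ℝ} {S T : Set ℝ}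

lemma integrable_ofReal_indicator (hf : Integrable f) (hS : MeasurableSet S) :
    Integrable fun x => ((S.indicator f x : ℝ) : ℂ) := (hf.indicator hS).ofReal

lemma sgnForm_indicator (hf : Integrable f) (hg : Integrable g)
    (hS : MeasurableSet S) (hT : MeasurableSet T) :
    sgnForm (fun x => ((S.indicator f x : ℝ) : ℂ)) (fun y => ((T.indicator g y : ℝ) : ℂ)) =
      ((∫ x in S, f x * ∫ y in T, g y * Real.sign (y - x) : ℝ) : ℂ) := by
  have hint := integrable_mul_sign (integrable_ofReal_indicator hf hS)
    (integrable_ofReal_indicator hg hT)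
  rw [← integral_complex_ofReal, ← integral_indicator hS]
  refine (integral_prod _ hint).trans (integral_congr_ae (Filter.Eventually.of_forall fun x => ?_))
  simp only [mul_assoc, integral_const_mul]
  by_cases hx : x ∈ S
  · rw [indicator_of_mem hx, indicator_of_mem hx, ← integral_indicator hT, Complex.ofReal_mul,
      ← integral_complex_ofReal]
    refine congrArg _ (integral_congr_ae (Filter.Eventually.of_forall fun y => ?_))
    simp only [indicator_mul_left, Complex.ofReal_mul]
  · rw [indicator_of_notMem hx, indicator_of_notMem hx, Complex.ofReal_zero, zero_mul]

lemma sgnForm_indicator_Iic_Ioi (hf : Integrable f) (hg : Integrable g) (s : ℝ) :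
    sgnForm (fun x => (((Iic s).indicator f x : ℝ) : ℂ))
        (fun y => (((Ioi s).indicator g y : ℝ) : ℂ)) =
      (((∫ x in Iic s, f x) * ∫ y in Ioi s, g y : ℝ) : ℂ) := by
  rw [sgnForm_indicator hf hg measurableSet_Iic measurableSet_Ioi, ← integral_mul_const]
  refine congrArg _ (setIntegral_congr_fun measurableSet_Iic fun x hx => congrArg (f x * ·) ?_)
  refine setIntegral_congr_fun measurableSet_Ioi fun y hy => ?_
  simp only [Real.sign_of_pos (sub_pos.2 ((mem_Iic.1 hx).trans_lt hy)), mul_one]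

lemma mul_markFactor (f : ℝ → ℝ) (s : ℝ) (ζ : ℂ) (x : ℝ) :
    f x * markFactor s ζ x =
      (((Iic s).indicator f x : ℝ) : ℂ) + ζ * (((Ioi s).indicator f x : ℝ) : ℂ) := by
  by_cases hx : s < x <;> simp [markFactor, hx, not_lt.1, mul_comm ζ]

lemma sgnForm_mul_markFactor (hf : Integrable f) (hg : Integrable g) (s : ℝ) (ζ : ℂ) :
    sgnForm (fun x => f x * markFactor s ζ x) (fun x => g x * markFactor s ζ x) =
      ((∫ x in Iic s, f x * ∫ y in Iic s, g y * Real.sign (y - x) : ℝ) : ℂ) +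
      ζ * (((∫ x in Iic s, f x) * (∫ y in Ioi s, g y) -
        (∫ x in Iic s, g x) * (∫ y in Ioi s, f y) : ℝ) : ℂ) +
      ζ ^ 2 * ((∫ x in Ioi s, f x * ∫ y in Ioi s, g y * Real.sign (y - x) : ℝ) : ℂ) := by
  simp only [mul_markFactor]
  rw [sgnForm_add_const_mul (integrable_ofReal_indicator hf measurableSet_Iic)
      (integrable_ofReal_indicator hf measurableSet_Ioi)
      (integrable_ofReal_indicator hg measurableSet_Iic)
      (integrable_ofReal_indicator hg measurableSet_Ioi),
    sgnForm_indicator hf hg measurableSet_Iic measurableSet_Iic,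
    sgnForm_indicator_Iic_Ioi hf hg, sgnForm_indicator_Iic_Ioi hg hf,
    sgnForm_indicator hf hg measurableSet_Ioi measurableSet_Ioi, Complex.ofReal_sub]

lemma integral_mul_markFactor (hf : Integrable f) (s : ℝ) (ζ : ℂ) :
    ∫ x, f x * markFactor s ζ x =
      ((∫ x in Iic s, f x : ℝ) : ℂ) + ζ * ((∫ x in Ioi s, f x : ℝ) : ℂ) := by
  simp only [mul_markFactor]
  rw [integral_add (integrable_ofReal_indicator hf measurableSet_Iic)
      ((integrable_ofReal_indicator hf measurableSet_Ioi).const_mul ζ), integral_const_mul,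
    ← integral_indicator measurableSet_Iic, ← integral_indicator measurableSet_Ioi,
    ← integral_complex_ofReal, ← integral_complex_ofReal]

variable {N : ℕ} {w : ℝ → ℝ}

lemma mul_markFactor_mul_eval_X_pow (w : ℝ → ℝ) (s : ℝ) (ζ : ℂ) (n : ℕ) (x : ℝ) :
    w x * markFactor s ζ x * ((X ^ n : ℝ[X]).eval x : ℝ) =
      ((w x * x ^ n : ℝ) : ℂ) * markFactor s ζ x := by
  rw [eval_pow, eval_X, Complex.ofReal_mul]
  ring

lemma momentMatrix_X_pow (hw : ∀ n : ℕ, Integrable fun x => w x * x ^ n) (s : ℝ) (ζ : ℂ)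
    (j k : Fin N) :
    momentMatrix (fun x => w x * markFactor s ζ x) (fun j : Fin N => X ^ (j : ℕ)) j k =
      ((∫ x in Iic s, w x * x ^ (j : ℕ) *
        ∫ y in Iic s, w y * y ^ (k : ℕ) * Real.sign (y - x) : ℝ) : ℂ) +
      ζ * (((∫ x in Iic s, w x * x ^ (j : ℕ)) * (∫ y in Ioi s, w y * y ^ (k : ℕ)) -
        (∫ x in Iic s, w x * x ^ (k : ℕ)) * (∫ y in Ioi s, w y * y ^ (j : ℕ)) : ℝ) : ℂ) +
      ζ ^ 2 * ((∫ x in Ioi s, w x * x ^ (j : ℕ) *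
        ∫ y in Ioi s, w y * y ^ (k : ℕ) * Real.sign (y - x) : ℝ) : ℂ) := by
  rw [← sgnForm_mul_markFactor (hw j) (hw k), momentMatrix, Matrix.of_apply]
  simp only [mul_markFactor_mul_eval_X_pow]

lemma momentVec_X_pow (hw : ∀ n : ℕ, Integrable fun x => w x * x ^ n) (s : ℝ) (ζ : ℂ)
    (j : Fin N) :
    momentVec (fun x => w x * markFactor s ζ x) (fun j : Fin N => X ^ (j : ℕ)) j =
      ((∫ x in Iic s, w x * x ^ (j : ℕ) : ℝ) : ℂ) +
        ζ * ((∫ x in Ioi s, w x * x ^ (j : ℕ) : ℝ) : ℂ) := by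
  rw [← integral_mul_markFactor (hw j), momentVec]
  simp only [mul_markFactor_mul_eval_X_pow]

end Splitting

section Gaussian

variable (N : ℕ) (ζ : ℂ) (s : ℝ)

lemma integrable_weightG_mul_pow (n : ℕ) : Integrable fun x => weightG x * x ^ n := by
  simpa only [weightG_eq_gaussWeight, eval_pow, eval_X] using
    (isPearson_gaussWeight one_half_pos).integrable (X ^ n)

lemma pow_mul_exp_eq_weightG_mul_pow (n : ℕ) (x : ℝ) :
    x ^ (n + 1 - 1) * Real.exp (-x ^ 2 / 2) = weightG x * x ^ n := by
  rw [weightG, Nat.add_sub_cancel, mul_comm]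

lemma matG_eq_scale_momentMatrix :
    matG N ζ s = Matrix.of fun j k : Fin N =>
      (Real.Gamma ((j + 1) / 2) : ℂ)⁻¹ * (Real.Gamma ((k + 1) / 2) : ℂ)⁻¹ *
        momentMatrix (fun x => weightG x * markFactor s ζ x)
          (fun j : Fin N => X ^ (j : ℕ)) j k := by
  ext j k
  simp only [matG, Matrix.of_apply, H0G, H1G, H2G, pow_mul_exp_eq_weightG_mul_pow,
    momentMatrix_X_pow integrable_weightG_mul_pow]
  push_cast
  ring

lemma nuG_eq_scale_momentVec :
    (fun j : Fin N => nuG ζ (j + 1) s) = fun j : Fin N => (Real.Gamma ((j + 1) / 2) : ℂ)⁻¹ *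
      momentVec (fun x => weightG x * markFactor s ζ x) (fun j : Fin N => X ^ (j : ℕ)) j := by
  ext j
  simp only [nuG, pow_mul_exp_eq_weightG_mul_pow, momentVec_X_pow integrable_weightG_mul_pow]
  push_cast
  ring

lemma prod_gaussNorm_inv :
    ∏ j : Fin N, (gaussNorm j)⁻¹ =
      2 ^ (-(N : ℝ) / 2) * ∏ j : Fin N, (Real.Gamma ((j + 1) / 2))⁻¹ := by
  have hsqrt : (2 : ℝ) ^ (-(N : ℝ) / 2) = (√2)⁻¹ ^ N := by
    rw [Real.sqrt_eq_rpow, ← Real.rpow_neg two_pos.le, ← Real.rpow_natCast,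
      ← Real.rpow_mul two_pos.le]
    ring_nf
  simp only [gaussNorm, mul_inv, Finset.prod_mul_distrib, Finset.prod_const, Finset.card_univ,
    Fintype.card_fin, hsqrt]

theorem genFun_weightG_eq_completedPfaffian_matG :
    genFun weightG N s ζ = (((2 : ℝ) ^ (-(N : ℝ) / 2) : ℝ) : ℂ) *
      completedPfaffian (matG N ζ s) fun j => nuG ζ (j + 1) s := by
  have hprod := congrArg Complex.ofReal (prod_gaussNorm_inv N)
  push_cast at hprod
  rw [genFun_weightG, matG_eq_scale_momentMatrix, nuG_eq_scale_momentVec,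
    completedPfaffian_scale _ (momentMatrix_skew _ _), hprod, ← mul_assoc]

end Gaussian

section Dilation

variable (f g : ℝ → ℂ) {c : ℝ}

lemma realSign_mul_of_pos (hc : 0 < c) (x : ℝ) : Real.sign (c * x) = Real.sign x := by
  rcases lt_trichotomy x 0 with h | rfl | h
  · rw [Real.sign_of_neg h, Real.sign_of_neg (mul_neg_of_pos_of_neg hc h)]
  · rw [mul_zero]
  · rw [Real.sign_of_pos h, Real.sign_of_pos (mul_pos hc h)]

lemma sgnForm_comp_mul_left (hc : 0 < c) :
    sgnForm f g = c ^ 2 * sgnForm (fun x => f (c * x)) (fun x => g (c * x)) := by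
  have hdil := Measure.integral_comp_smul (volume : Measure (ℝ × ℝ))
    (fun p => f p.1 * g p.2 * ((Real.sign (p.2 - p.1) : ℝ) : ℂ)) c
  simp only [Prod.smul_fst, Prod.smul_snd, smul_eq_mul, ← mul_sub, realSign_mul_of_pos hc,
    Module.finrank_prod, Module.finrank_self] at hdil
  have hc' : (c : ℂ) ≠ 0 := by exact_mod_cast hc.ne'
  rw [sgnForm, sgnForm, hdil, abs_of_pos (by positivity), Complex.real_smul]
  push_cast
  field_simp

lemma sgnForm_const_mul (a b : ℂ) :
    sgnForm (fun x => a * f x) (fun x => b * g x) = a * b * sgnForm f g := by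
  rw [sgnForm, sgnForm, ← integral_const_mul]
  refine integral_congr_ae (Filter.Eventually.of_forall fun p => ?_)
  ring

end Dilation

section Laguerre

variable {a : ℝ} (N : ℕ) (ζ : ℂ) {s t : ℝ}

lemma integrable_laguerreWeight_mul_pow (ha : -1 < a) (n : ℕ) :
    Integrable fun x => laguerreWeight a 1 x * x ^ n := by
  simpa only [eval_pow, eval_X] using (isPearson_laguerreWeight ha one_pos).integrable (X ^ n)

lemma weightL_two_mul (a x : ℝ) : weightL a (2 * x) = 2 ^ a * laguerreWeight a 1 x := by
  rcases lt_or_ge 0 x with hx | hx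
  · rw [weightL, if_pos (by positivity), laguerreWeight_of_pos hx, Real.mul_rpow two_pos.le hx.le]
    ring_nf
  · rw [weightL, if_neg (by linarith), laguerreWeight_of_nonpos hx, mul_zero]

lemma markFactor_two_mul (s : ℝ) (ζ : ℂ) (x : ℝ) :
    markFactor s ζ (2 * x) = markFactor (s / 2) ζ x := by
  simp only [markFactor, div_lt_iff₀' (two_pos (α := ℝ))]

lemma weightL_mul_markFactor_mul_eval_two_mul (a s : ℝ) (n : ℕ) (x : ℝ) :
    weightL a (2 * x) * markFactor s ζ (2 * x) * ((X ^ n : ℝ[X]).eval (2 * x) : ℝ) =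
      ((2 ^ (a + n) : ℝ) : ℂ) *
        (laguerreWeight a 1 x * markFactor (s / 2) ζ x * ((X ^ n : ℝ[X]).eval x : ℝ)) := by
  rw [weightL_two_mul, markFactor_two_mul, eval_pow, eval_pow, eval_X, eval_X, mul_pow,
    Real.rpow_add two_pos, Real.rpow_natCast]
  push_cast
  ring

lemma momentMatrix_weightL (a s : ℝ) :
    momentMatrix (fun x => weightL a x * markFactor s ζ x) (fun j : Fin N => X ^ (j : ℕ)) =
      Matrix.of fun j k : Fin N => ((2 ^ (a + j + 1) : ℝ) : ℂ) * ((2 ^ (a + k + 1) : ℝ) : ℂ) *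
        momentMatrix (fun x => laguerreWeight a 1 x * markFactor (s / 2) ζ x)
          (fun j : Fin N => X ^ (j : ℕ)) j k := by
  ext j k
  rw [momentMatrix, momentMatrix, Matrix.of_apply, Matrix.of_apply, Matrix.of_apply,
    sgnForm_comp_mul_left _ _ two_pos]
  simp only [weightL_mul_markFactor_mul_eval_two_mul, sgnForm_const_mul,
    Real.rpow_add_one two_ne_zero]
  push_cast
  ring

lemma momentVec_weightL (a s : ℝ) :
    momentVec (fun x => weightL a x * markFactor s ζ x) (fun j : Fin N => X ^ (j : ℕ)) =
      fun j : Fin N => ((2 ^ (a + j + 1) : ℝ) : ℂ) *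
        momentVec (fun x => laguerreWeight a 1 x * markFactor (s / 2) ζ x)
          (fun j : Fin N => X ^ (j : ℕ)) j := by
  ext j
  have hdil := Measure.integral_comp_mul_left
    (fun x => (weightL a x * markFactor s ζ x * ((X ^ (j : ℕ) : ℝ[X]).eval x : ℝ) : ℂ)) 2
  rw [abs_of_pos (by positivity), ← inv_smul_eq_iff₀ (by positivity), inv_inv] at hdil
  rw [momentVec, momentVec, ← hdil]
  simp only [weightL_mul_markFactor_mul_eval_two_mul, integral_const_mul, Complex.real_smul,
    Real.rpow_add_one two_ne_zero]
  push_cast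
  ring

lemma intervalIntegral_rpow_mul_exp (ht : 0 ≤ t) (b : ℝ) (f : ℝ → ℝ) :
    ∫ x in (0 : ℝ)..t, x ^ b * Real.exp (-x) * f x = ∫ x in Iic t, laguerreWeight b 1 x * f x := by
  rw [intervalIntegral.integral_of_le ht, setIntegral_eq_of_subset_of_forall_sdiff_eq_zero
    measurableSet_Iic Ioc_subset_Iic_self fun x hx => ?_]
  · refine setIntegral_congr_fun measurableSet_Ioc fun x hx => ?_
    simp only [laguerreWeight_of_pos hx.1, one_mul]
  · rw [laguerreWeight_of_nonpos (not_lt.1 fun h => hx.2 ⟨h, hx.1⟩), zero_mul]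

lemma integral_Ioi_rpow_mul_exp (ht : 0 ≤ t) (b : ℝ) (f : ℝ → ℝ) :
    ∫ x in Ioi t, x ^ b * Real.exp (-x) * f x = ∫ x in Ioi t, laguerreWeight b 1 x * f x :=
  setIntegral_congr_fun measurableSet_Ioi fun x hx => by
    simp only [laguerreWeight_of_pos (ht.trans_lt hx), one_mul]

lemma matL_eq_scale_momentMatrix (ha : -1 < a) (ht : 0 ≤ t) :
    matL a N ζ t = Matrix.of fun j k : Fin N =>
      (Real.Gamma (a + (j + 1)) : ℂ)⁻¹ * (Real.Gamma (a + (k + 1)) : ℂ)⁻¹ *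
        momentMatrix (fun x => laguerreWeight a 1 x * markFactor t ζ x)
          (fun j : Fin N => X ^ (j : ℕ)) j k := by
  have hexp (n : ℕ) : a + ((n + 1 : ℕ) : ℝ) - 1 = a + n := by push_cast; ring
  have hIic (b : ℝ) := intervalIntegral_rpow_mul_exp ht b 1
  have hIoi (b : ℝ) := integral_Ioi_rpow_mul_exp ht b 1
  simp only [Pi.one_apply, mul_one] at hIic hIoi
  ext j k
  simp only [matL, Matrix.of_apply, H0L, H1L, H2L, hexp, intervalIntegral_rpow_mul_exp ht,
    integral_Ioi_rpow_mul_exp ht, hIic, hIoi,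
    momentMatrix_X_pow (integrable_laguerreWeight_mul_pow ha), laguerreWeight_mul_pow]
  push_cast
  ring

lemma nuL_eq_scale_momentVec (ha : -1 < a) (ht : 0 ≤ t) :
    (fun j : Fin N => nuL a ζ (j + 1) t) = fun j : Fin N => (Real.Gamma (a + (j + 1)) : ℂ)⁻¹ *
      momentVec (fun x => laguerreWeight a 1 x * markFactor t ζ x)
        (fun j : Fin N => X ^ (j : ℕ)) j := by
  have hexp (n : ℕ) : a + ((n + 1 : ℕ) : ℝ) - 1 = a + n := by push_cast; ring
  have hIic (b : ℝ) := intervalIntegral_rpow_mul_exp ht b 1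
  have hIoi (b : ℝ) := integral_Ioi_rpow_mul_exp ht b 1
  simp only [Pi.one_apply, mul_one] at hIic hIoi
  ext j
  simp only [nuL, hexp, hIic, hIoi,
    momentVec_X_pow (integrable_laguerreWeight_mul_pow ha), laguerreWeight_mul_pow]
  push_cast
  ring

lemma constL_eq_prod_fin (a : ℝ) :
    constL a N = ∏ j : Fin N, √Real.pi * Real.Gamma (a + (j + 1)) /
      (Real.Gamma ((j + 1) / 2) * Real.Gamma (a + (j + 2) / 2)) := by
  rw [constL, ← Finset.prod_range fun j : ℕ => √Real.pi * Real.Gamma (a + (j + 1)) /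
    (Real.Gamma ((j + 1) / 2) * Real.Gamma (a + (j + 2) / 2)), Finset.range_eq_Ico,
    ← Finset.Ico_add_one_right_eq_Icc, Finset.prod_Ico_eq_prod_range]
  refine Finset.prod_congr (by simp) fun j _ => ?_
  push_cast
  ring_nf

lemma prod_laguerreNorm_inv (ha : -1 < a) :
    (∏ j : Fin N, (laguerreNorm a j)⁻¹) * ∏ j : Fin N, (2 : ℝ) ^ (a + j + 1) =
      constL a N * ∏ j : Fin N, (Real.Gamma (a + (j + 1)))⁻¹ := by
  rw [constL_eq_prod_fin, ← Finset.prod_mul_distrib, ← Finset.prod_mul_distrib]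
  refine Finset.prod_congr rfl fun j _ => ?_
  have hΓ : Real.Gamma (a + (j + 1)) ≠ 0 :=
    (Real.Gamma_pos_of_pos (by linarith [(j : ℕ).cast_nonneg (α := ℝ)])).ne'
  have hpow : (2 : ℝ) ^ (a + j + 1) ≠ 0 := by positivity
  rw [laguerreNorm]
  field_simp

theorem genFun_weightL_eq_completedPfaffian_matL (ha : -1 < a) (hs : 0 ≤ s) :
    genFun (weightL a) N s ζ = (constL a N : ℂ) *
      completedPfaffian (matL a N ζ (s / 2)) fun j => nuL a ζ (j + 1) (s / 2) := by
  have hs' : 0 ≤ s / 2 := by positivity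
  have hprod := congrArg Complex.ofReal (prod_laguerreNorm_inv N ha)
  push_cast at hprod
  rw [genFun_weightL ha, momentMatrix_weightL, momentVec_weightL,
    completedPfaffian_scale _ (momentMatrix_skew _ _), ← mul_assoc,
    matL_eq_scale_momentMatrix N ζ ha hs', nuL_eq_scale_momentVec N ζ ha hs',
    completedPfaffian_scale _ (momentMatrix_skew _ _), ← mul_assoc, hprod]

end Laguerre

end OrthogonalEnsembles

end

theorem mainTheorem1 (N : ℕ) (ζ : ℂ) :
    (∀ s : ℝ,
      (Even N →
        OrthogonalEnsembles.genFun OrthogonalEnsembles.weightG N s ζ =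
          (((2 : ℝ) ^ (-(N : ℝ) / 2) : ℝ) : ℂ) *
            OrthogonalEnsembles.pfaffian (OrthogonalEnsembles.matG N ζ s)) ∧
      (Odd N →
        OrthogonalEnsembles.genFun OrthogonalEnsembles.weightG N s ζ =
          (((2 : ℝ) ^ (-(N : ℝ) / 2) : ℝ) : ℂ) *
            OrthogonalEnsembles.pfaffian
              (OrthogonalEnsembles.bordered (OrthogonalEnsembles.matG N ζ s)
                (fun j => OrthogonalEnsembles.nuG ζ (j + 1) s)))) ∧
    (∀ a : ℝ, -1 < a → ∀ s : ℝ, 0 ≤ s →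
      (Even N →
        OrthogonalEnsembles.genFun (OrthogonalEnsembles.weightL a) N s ζ =
          (OrthogonalEnsembles.constL a N : ℂ) *
            OrthogonalEnsembles.pfaffian (OrthogonalEnsembles.matL a N ζ (s / 2))) ∧
      (Odd N →
        OrthogonalEnsembles.genFun (OrthogonalEnsembles.weightL a) N s ζ =
          (OrthogonalEnsembles.constL a N : ℂ) *
            OrthogonalEnsembles.pfaffian
              (OrthogonalEnsembles.bordered (OrthogonalEnsembles.matL a N ζ (s / 2))
                (fun j => OrthogonalEnsembles.nuL a ζ (j + 1) (s / 2))))) := by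
  open OrthogonalEnsembles in
  refine ⟨fun s => ?_, fun a ha s hs => ?_⟩
  · have h := genFun_weightG_eq_completedPfaffian_matG N ζ s
    refine ⟨fun hN => ?_, fun hN => ?_⟩
    · rwa [completedPfaffian, if_pos hN] at h
    · rwa [completedPfaffian, if_neg (Nat.not_even_iff_odd.2 hN)] at h
  · have h := genFun_weightL_eq_completedPfaffian_matL N ζ ha hs
    refine ⟨fun hN => ?_, fun hN => ?_⟩
    · rwa [completedPfaffian, if_pos hN] at h
    · rwa [completedPfaffian, if_neg (Nat.not_even_iff_odd.2 hN)] at h
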